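/- For integers $p,r\ge 2$ put $n=pr$ and consider the balanced one-way random effects model $$y_{ij}=\mu+a_i+\varepsilon_{ij},\qquad 1\le i\le p,\ 1\le j\le r,$$ where $\mu\in\mathbb R$, all $a_i\sim N(0,\sigma_a^2)$ and $\varepsilon_{ij}\sim N(0,\sigma^2)$ are mutually independent, $\sigma^2>0$ and $\sigma_a^2\ge 0$. Consider testing $M_0:\sigma_a^2=0$ against $M_1:\sigma_a^2\neq 0$ by the Bayes factor $BF_{10}=m_1(\mathbf Y)/m_0(\mathbf Y)$, the ratio of the marginal likelihoods for the priors $\pi_0(\mu,\sigma^2)=c/\sigma^2$ under $M_0$ and $\pi_1(\mu,\sigma^2,\sigma_a^2)=\frac{c}{\sigma^2}\cdot\frac1{\sigma^2}\,\pi\!\left(\frac{\sigma_a^2}{\sigma^2}\right)$ under $M_1$. Here $c>0$ and $\pi$ is the Pearson type VI density $$\pi(\tau)=\frac{\kappa(\kappa\tau)^{\beta}(1+\kappa\tau)^{-\alpha-\beta-2}}{B(\alpha+1,\beta+1)},\quad \tau>0,\qquad \kappa=r,\quad \beta=\frac{p(r-1)}2-\alpha-2,$$ with a fixed $\alpha>-1$.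 With $\bar y_{i\cdot}=\frac1r\sum_j y_{ij}$, $\bar y_{\cdot\cdot}=\frac1n\sum_{i,j}y_{ij}$, $W_E=\sum_{i,j}(y_{ij}-\bar y_{i\cdot})^2$ and $W_T=\sum_{i,j}(y_{ij}-\bar y_{\cdot\cdot})^2$, this Bayes factor has, whenever $\beta>-1$ and $W_E>0$, the closed form $$BF_{10}=\frac{\Gamma(p/2+\alpha+1/2)\,\Gamma((n-p)/2)}{\Gamma((n-1)/2)\,\Gamma(\alpha+1)}\left(\frac{W_E}{W_T}\right)^{-(n-p-2)/2+\alpha}.$$ Call it consistent under $M_0$ if, when the data come from the model with $\sigma_a^2=0$, this closed form tends to $0$ in probability, and consistent under $M_1$ if, when the data come from the model with a fixed $\sigma_a^2>0$, it tends to $\infty$ in probability. Then, for all fixed $\mu$ and $\sigma^2>0$: (a) As $r\to\infty$ with $p\ge2$ fixed, the Bayes factor is consistent under $M_0$ and under $M_1$ (for every $\sigma_a^2>0$). (b) As $p\to\infty$ with $r\ge2$ fixed, the Bayes factor is consistent under $M_0$, and it is consistent under $M_1$ if $\sigma_a^2/\sigma^2>h(r)$, where $h(r)=r^{1/(r-1)}-1$;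 it is inconsistent (i.e. not consistent) under $M_1$ if $0<\sigma_a^2/\sigma^2<h(r)$. (c) As $p\to\infty$ and $r\to\infty$ jointly, the Bayes factor is consistent under $M_0$ and under $M_1$ (for every $\sigma_a^2>0$). -/

import Mathlib

open MeasureTheory ProbabilityTheory Filter Topology
open scoped NNReal ENNReal Matrix

namespace OneWay

noncomputable section

/-! ### The balanced one-way random effects model -/

/-- The law of the data `y i j = μ + a i + ε i j` (`i < p` units, `j < r` observations per unit),
where all `a i ∼ N(0, σa2)` and all `ε i j ∼ N(0, σ2)` are mutually independent. -/
def dataLaw (p r : ℕ) (μ : ℝ) (σa2 σ2 : ℝ≥0) : Measure (Fin p → Fin r → ℝ) :=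
  ((Measure.pi fun _ : Fin p => gaussianReal 0 σa2).prod
    (Measure.pi fun _ : Fin p => Measure.pi fun _ : Fin r => gaussianReal 0 σ2)).map
    fun z i j => μ + z.1 i + z.2 i j

/-- Density at `x` of the `r`-variate normal distribution with mean `θ` and covariance `Ψ`. -/
def normalDensity {r : ℕ} (x θ : Fin r → ℝ) (Ψ : Matrix (Fin r) (Fin r) ℝ) : ℝ :=
  (2 * Real.pi) ^ (-(r : ℝ) / 2) * Ψ.det ^ (-(1 / 2) : ℝ) *
    Real.exp (-(1 / 2) * ((x - θ) ⬝ᵥ (Ψ⁻¹ *ᵥ (x - θ))))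

/-- The likelihood `∏ i, N_r(y i ∣ μ 1, s I + sa J)`, with `s` the error variance, `sa` the variance
of the random effects, and `J` the all-ones matrix. -/
def likelihood {p r : ℕ} (Y : Fin p → Fin r → ℝ) (μ s sa : ℝ) : ℝ :=
  ∏ i, normalDensity (Y i) (fun _ => μ)
    (s • (1 : Matrix (Fin r) (Fin r) ℝ) + sa • Matrix.of fun _ _ => 1)

/-! ### Priors, marginal likelihoods and the Bayes factor -/

/-- The noninformative prior `c / σ²` for `(μ, σ²)`. -/
def prior0 (c : ℝ) (_μ s : ℝ) : ℝ := c / s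

/-- The Pearson type VI density with shape parameters `α`, `β` and scale `κ`. -/
def pearsonVI (α β κ τ : ℝ) : ℝ :=
  (Set.Ioi (0 : ℝ)).indicator
    (fun t => κ * (κ * t) ^ β * (1 + κ * t) ^ (-α - β - 2) / ProbabilityTheory.beta (α + 1) (β + 1))
    τ

/-- The hyperparameter `β = p (r - 1) / 2 - α - 2`. -/
def shapeBeta (p r : ℕ) (α : ℝ) : ℝ := (p : ℝ) * ((r : ℝ) - 1) / 2 - α - 2

/-- The prior for `(μ, σ², σa²)` under the alternative: the ratio `σa² / σ²` has the Pearson type VI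
density with shapes `α`, `β = p (r - 1) / 2 - α - 2` and scale `κ = r`. -/
def prior1 (p r : ℕ) (α c : ℝ) (μ s sa : ℝ) : ℝ :=
  prior0 c μ s * (1 / s * pearsonVI α (shapeBeta p r α) r (sa / s))

/-- Marginal likelihood of the data under the null model. -/
def marginal0 {p r : ℕ} (c : ℝ) (Y : Fin p → Fin r → ℝ) : ℝ≥0∞ :=
  ∫⁻ μ : ℝ, ∫⁻ s in Set.Ioi (0 : ℝ), ENNReal.ofReal (likelihood Y μ s 0 * prior0 c μ s)

/-- Marginal likelihood of the data under the alternative model. -/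
def marginal1 {p r : ℕ} (α c : ℝ) (Y : Fin p → Fin r → ℝ) : ℝ≥0∞ :=
  ∫⁻ μ : ℝ, ∫⁻ s in Set.Ioi (0 : ℝ), ∫⁻ sa in Set.Ioi (0 : ℝ),
    ENNReal.ofReal (likelihood Y μ s sa * prior1 p r α c μ s sa)

/-- The Bayes factor of the alternative against the null model. -/
def bayesFactor {p r : ℕ} (α c : ℝ) (Y : Fin p → Fin r → ℝ) : ℝ≥0∞ :=
  marginal1 α c Y / marginal0 c Y

/-! ### The closed form -/

/-- The mean of the observations on unit `i`. -/
def unitMean {p r : ℕ} (Y : Fin p → Fin r → ℝ) (i : Fin p) : ℝ := (∑ j, Y i j) / r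

/-- The mean of all observations. -/
def grandMean {p r : ℕ} (Y : Fin p → Fin r → ℝ) : ℝ := (∑ i, ∑ j, Y i j) / ((p : ℝ) * r)

/-- The sum of squares within groups. -/
def withinSS {p r : ℕ} (Y : Fin p → Fin r → ℝ) : ℝ := ∑ i, ∑ j, (Y i j - unitMean Y i) ^ 2

/-- The total sum of squares. -/
def totalSS {p r : ℕ} (Y : Fin p → Fin r → ℝ) : ℝ := ∑ i, ∑ j, (Y i j - grandMean Y) ^ 2

/-- The closed-form Bayes factor
`Γ(p/2 + α + 1/2) Γ((n-p)/2) / (Γ((n-1)/2) Γ(α+1)) * (W_E / W_T) ^ (-(n-p-2)/2 + α)`, `n = p r`. -/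
def closedBF {p r : ℕ} (α : ℝ) (Y : Fin p → Fin r → ℝ) : ℝ :=
  Real.Gamma ((p : ℝ) / 2 + α + 1 / 2) * Real.Gamma (((p : ℝ) * r - p) / 2) /
      (Real.Gamma (((p : ℝ) * r - 1) / 2) * Real.Gamma (α + 1)) *
    (withinSS Y / totalSS Y) ^ (-((p : ℝ) * r - p - 2) / 2 + α)

/-! ### Consistency -/

/-- The `X k`, each a random variable on its own space, tend to `0` in probability along `l`. -/
def PlimZero {ι : Type*} (l : Filter ι) {Ω : ι → Type*} [∀ k, MeasurableSpace (Ω k)]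
    (P : ∀ k, Measure (Ω k)) (X : ∀ k, Ω k → ℝ) : Prop :=
  ∀ δ : ℝ, 0 < δ → Tendsto (fun k => P k {ω | δ ≤ |X k ω|}) l (𝓝 0)

/-- The `X k`, each a random variable on its own space, tend to `∞` in probability along `l`. -/
def PlimTop {ι : Type*} (l : Filter ι) {Ω : ι → Type*} [∀ k, MeasurableSpace (Ω k)]
    (P : ∀ k, Measure (Ω k)) (X : ∀ k, Ω k → ℝ) : Prop :=
  ∀ C : ℝ, Tendsto (fun k => P k {ω | X k ω ≤ C}) l (𝓝 0)

/-- Consistency of the closed-form Bayes factor at the true parameter `(μ, σa2, σ2)`, as the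
dimensions `(p k, r k)` of the data vary along `l`: in probability it tends to `0` if the null model
is true (`σa2 = 0`) and to `∞` if the alternative is true (`σa2 ≠ 0`). -/
def IsConsistent (α μ : ℝ) (σa2 σ2 : ℝ≥0) {ι : Type*} (l : Filter ι) (p r : ι → ℕ) : Prop :=
  (σa2 = 0 → PlimZero l (fun k => dataLaw (p k) (r k) μ σa2 σ2) fun _ Y => closedBF α Y) ∧
  (σa2 ≠ 0 → PlimTop l (fun k => dataLaw (p k) (r k) μ σa2 σ2) fun _ Y => closedBF α Y)

/-- The threshold `h(r) = r ^ (1 / (r - 1)) - 1`. -/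
def threshold (r : ℕ) : ℝ := (r : ℝ) ^ (1 / ((r : ℝ) - 1)) - 1

end

end OneWay

namespace OneWay

section

/-! ### Sums of squares -/

/-! Write E and H for the sums of squares within and between groups. The likelihood depends on the
data only through E, H and the grand mean. In the coordinates t = r σa²/σ², w = σ² + r σa², the
choice of β makes all powers of 1 + t cancel, so t integrates to a Gamma function and what remains
is a normal–inverse-gamma integral of the same type as in the null marginal. The quotient is the
closed form (`bayesFactor_eq_closedBF`).

For consistency, rewrite the closed form as a Gamma factor times (1 + H/E)^(p(r-1)/2 - (1+α)). Crude
Stirling bounds, uniform in p and r, give log(Gamma factor) = -(p/2) `gammaRate r` + O(log(pr))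
(`exists_abs_log_gammaFactor_add_le`). Hence the sign of (r-1) log(1 + H/E) - `gammaRate r` decides
the limit whenever its product with p dominates log(pr).

If p → ∞, Chebyshev's inequality over the independent units puts H/E close to (σ² + r
σa²)/((r-1)σ²), where the rate equals (r-1) log(1 + σa²/σ²) - log r. This is -log r under the null
model and changes sign exactly at σa²/σ² = h(r).

If p is fixed, H does not concentrate. Under the null model it is still bounded in probability, so
the power of 1 + H/E stays bounded while the Gamma factor tends to 0
(`tendsto_Gamma_div_Gamma_add`). Under the alternative H/E stays away from 0 with high probability,
by a small-ball estimate for the difference of two unit means (`betweenSS_le_le`), and the power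
then grows exponentially in r against a Gamma factor that decays polynomially. -/

theorem sum_sub_sq_eq {ι : Type*} (s : Finset ι) (x : ι → ℝ) (c : ℝ) (hs : s.Nonempty) :
    ∑ i ∈ s, (x i - c) ^ 2 = ∑ i ∈ s, (x i - (∑ k ∈ s, x k) / s.card) ^ 2
      + s.card * ((∑ k ∈ s, x k) / s.card - c) ^ 2 := by
  have hc : (s.card : ℝ) ≠ 0 := by simpa using hs.ne_empty
  set m := (∑ k ∈ s, x k) / s.card with hm
  have h0 : ∑ i ∈ s, (x i - m) = 0 := by
    rw [Finset.sum_sub_distrib, Finset.sum_const, nsmul_eq_mul, hm]; field_simp; ring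
  have : ∀ i, (x i - c) ^ 2 = (x i - m) ^ 2 + 2 * (m - c) * (x i - m) + (m - c) ^ 2 := by
    intro i; ring
  simp_rw [this, Finset.sum_add_distrib, ← Finset.mul_sum, h0]
  simp

variable {p r : ℕ}

theorem sum_row_sub_sq (hr : r ≠ 0) (Y : Fin p → Fin r → ℝ) (c : ℝ) (i : Fin p) :
    ∑ j, (Y i j - c) ^ 2 = ∑ j, (Y i j - unitMean Y i) ^ 2 + r * (unitMean Y i - c) ^ 2 := by
  have : NeZero r := ⟨hr⟩
  have := sum_sub_sq_eq Finset.univ (Y i) c Finset.univ_nonempty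
  simpa [unitMean] using this

/-- The sum of squares between groups. -/
noncomputable def betweenSS (Y : Fin p → Fin r → ℝ) : ℝ :=
  r * ∑ i, (unitMean Y i - grandMean Y) ^ 2

theorem betweenSS_nonneg (Y : Fin p → Fin r → ℝ) : 0 ≤ betweenSS Y := by
  unfold betweenSS; positivity

theorem totalSS_eq (hr : r ≠ 0) (Y : Fin p → Fin r → ℝ) :
    totalSS Y = withinSS Y + betweenSS Y := by
  unfold totalSS withinSS betweenSS
  rw [Finset.sum_congr rfl fun i _ => sum_row_sub_sq hr Y (grandMean Y) i, Finset.sum_add_distrib,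
    Finset.mul_sum]

theorem grandMean_eq (hr : r ≠ 0) (Y : Fin p → Fin r → ℝ) :
    grandMean Y = (∑ i, unitMean Y i) / p := by
  have : (r : ℝ) ≠ 0 := by exact_mod_cast hr
  unfold grandMean unitMean
  rw [← Finset.sum_div]; field_simp

theorem sum_unitMean_sub_sq (hp : p ≠ 0) (hr : r ≠ 0) (Y : Fin p → Fin r → ℝ) (c : ℝ) :
    r * ∑ i, (unitMean Y i - c) ^ 2 = betweenSS Y + p * r * (grandMean Y - c) ^ 2 := by
  have : NeZero p := ⟨hp⟩
  have := sum_sub_sq_eq Finset.univ (unitMean Y) c Finset.univ_nonempty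
  rw [Finset.card_univ, Fintype.card_fin, ← grandMean_eq hr] at this
  rw [this, betweenSS]; ring

/-! ### The likelihood -/

/-- The covariance is s times a rank-one update of the identity, so the matrix determinant lemma
applies. -/
theorem det_compoundSymmetric (hr : r ≠ 0) (s sa : ℝ) (hs : s ≠ 0) :
    (s • (1 : Matrix (Fin r) (Fin r) ℝ) + sa • Matrix.of fun _ _ => 1).det
      = s ^ (r - 1) * (s + r * sa) := by
  have : (s • (1 : Matrix (Fin r) (Fin r) ℝ) + sa • Matrix.of fun _ _ => 1)
      = s • (1 + Matrix.replicateCol Unit (fun _ => sa / s) *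
        Matrix.replicateRow Unit fun _ => (1 : ℝ)) := by
    ext i j
    simp [Matrix.mul_apply, Matrix.add_apply]
    field_simp
  rw [this, Matrix.det_smul, Matrix.det_one_add_replicateCol_mul_replicateRow]
  obtain ⟨k, rfl⟩ := Nat.exists_eq_succ_of_ne_zero hr
  simp [dotProduct]
  field_simp
  ring

theorem quadForm_compoundSymmetric (s sa : ℝ) (hs : 0 < s) (hsa : 0 ≤ sa)
    (d : Fin r → ℝ) :
    d ⬝ᵥ ((s • (1 : Matrix (Fin r) (Fin r) ℝ) + sa • Matrix.of fun _ _ => 1)⁻¹ *ᵥ d)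
      = (∑ j, d j ^ 2 - sa / (s + r * sa) * (∑ j, d j) ^ 2) / s := by
  rcases Nat.eq_zero_or_pos r with rfl | hr
  · simp [dotProduct]
  set Ψ := s • (1 : Matrix (Fin r) (Fin r) ℝ) + sa • Matrix.of fun _ _ => 1 with hΨ
  have hv : 0 < s + r * sa := by positivity
  have hdet : IsUnit Ψ.det := by
    rw [hΨ, det_compoundSymmetric hr.ne' s sa hs.ne', isUnit_iff_ne_zero]; positivity
  -- The Sherman–Morrison solution of Ψ w = d. Verifying it directly avoids computing the inverse
  -- matrix.
  set w : Fin r → ℝ := fun j => (d j - sa / (s + r * sa) * ∑ k, d k) / s with hw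
  have h1 : Ψ *ᵥ w = d := by
    ext i
    have h2 : (Ψ *ᵥ w) i = s * w i + sa * ∑ j, w j := by
      rw [hΨ, Matrix.add_mulVec, Matrix.smul_mulVec, Matrix.smul_mulVec, Matrix.one_mulVec]
      simp [Matrix.mulVec, dotProduct]
    have h3 : ∑ j, w j = (∑ k, d k) / (s + r * sa) := by
      simp only [hw]
      rw [← Finset.sum_div, Finset.sum_sub_distrib, Finset.sum_const]
      simp; field_simp; ring
    rw [h2, h3, hw]; field_simp; ring
  have h4 : Ψ⁻¹ *ᵥ d = w := by
    conv_lhs => rw [← h1]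
    rw [Matrix.mulVec_mulVec, Matrix.nonsing_inv_mul _ hdet, Matrix.one_mulVec]
  rw [h4]
  have h5 : ∀ j, d j * w j = (d j ^ 2 - sa / (s + r * sa) * (∑ k, d k) * d j) / s := by
    intro j; simp only [hw]; ring
  simp only [dotProduct, h5]
  rw [← Finset.sum_div, Finset.sum_sub_distrib, ← Finset.mul_sum]; ring

/-- The covariance has eigenvalue s + r sa on constant vectors and s on their orthogonal complement.
Each row therefore splits into its deviations from the unit mean, scaled by s, and the unit mean
itself, scaled by s + r sa. -/
theorem likelihood_eq (hp : p ≠ 0) (hr : r ≠ 0) (Y : Fin p → Fin r → ℝ) (μ s sa : ℝ) (hs : 0 < s)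
    (hsa : 0 ≤ sa) :
    likelihood Y μ s sa = (2 * Real.pi) ^ (-((p : ℝ) * r) / 2) * s ^ (-((p : ℝ) * (r - 1) / 2)) *
      (s + r * sa) ^ (-((p : ℝ) / 2)) *
      Real.exp (-((withinSS Y / s + (betweenSS Y + p * r * (grandMean Y - μ) ^ 2) / (s + r * sa))
        / 2)) := by
  have hv : 0 < s + r * sa := by positivity
  have hr' : (r : ℝ) ≠ 0 := by exact_mod_cast hr
  have hrow : ∀ i, normalDensity (Y i) (fun _ => μ)
      (s • (1 : Matrix (Fin r) (Fin r) ℝ) + sa • Matrix.of fun _ _ => 1)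
      = (2 * Real.pi) ^ (-(r : ℝ) / 2) * (s ^ (-(((r : ℝ) - 1) / 2)) *
        (s + r * sa) ^ (-(1 / 2) : ℝ)) *
        Real.exp (-((((∑ j, (Y i j - unitMean Y i) ^ 2) / s
          + r * (unitMean Y i - μ) ^ 2 / (s + r * sa))) / 2)) := by
    intro i
    rw [normalDensity, det_compoundSymmetric hr s sa hs.ne', quadForm_compoundSymmetric s sa hs hsa]
    congr 2
    · rw [Real.mul_rpow (by positivity) hv.le, ← Real.rpow_natCast, ← Real.rpow_mul hs.le,
        Nat.cast_sub (Nat.one_le_iff_ne_zero.2 hr)]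
      congr 2
      push_cast; ring
    · have e1 : ∑ j, (Y i - fun _ => μ : Fin r → ℝ) j = r * (unitMean Y i - μ) := by
        simp [unitMean]; field_simp
      have e2 : ∑ j, (Y i - fun _ => μ : Fin r → ℝ) j ^ 2
          = ∑ j, (Y i j - unitMean Y i) ^ 2 + r * (unitMean Y i - μ) ^ 2 := by
        rw [← sum_row_sub_sq hr]; simp
      rw [e1, e2]
      field_simp; ring
  unfold likelihood
  simp_rw [hrow]
  rw [Finset.prod_mul_distrib, Finset.prod_const, Finset.card_univ, Fintype.card_fin,
    ← Real.exp_sum, mul_pow, mul_pow]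
  have hpow : ∀ {x e : ℝ}, 0 ≤ x → (x ^ e) ^ p = x ^ (p * e) := by
    intro x e hx; rw [← Real.rpow_mul_natCast hx]; ring_nf
  rw [hpow (by positivity), hpow hs.le, hpow hv.le]
  have e3 : ∑ i, -(((∑ j, (Y i j - unitMean Y i) ^ 2) / s
          + r * (unitMean Y i - μ) ^ 2 / (s + r * sa)) / 2)
      = -((withinSS Y / s + (betweenSS Y + p * r * (grandMean Y - μ) ^ 2) / (s + r * sa)) / 2) := by
    rw [Finset.sum_neg_distrib, ← Finset.sum_div, Finset.sum_add_distrib, ← Finset.sum_div,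
      ← Finset.sum_div, ← Finset.mul_sum, sum_unitMean_sub_sq hp hr]
    rfl
  rw [e3]
  ring_nf

/-! ### Lebesgue integrals -/

/-- Integrability comes for free: a non-integrable function has Bochner integral 0 by convention,
which positivity excludes. -/
theorem lintegral_ofReal_of_integral_pos {X : Type*} [MeasurableSpace X] {m : Measure X}
    {f : X → ℝ} (hf : 0 ≤ᵐ[m] f) (h : 0 < ∫ x, f x ∂m) :
    ∫⁻ x, ENNReal.ofReal (f x) ∂m = ENNReal.ofReal (∫ x, f x ∂m) :=
  (ofReal_integral_eq_lintegral_ofReal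
    (not_imp_comm.1 integral_undef h.ne') hf).symm

theorem lintegral_gamma {a b : ℝ} (ha : 0 < a) (hb : 0 < b) :
    ∫⁻ t in Set.Ioi (0 : ℝ), ENNReal.ofReal (t ^ (a - 1) * Real.exp (-(b * t)))
      = ENNReal.ofReal ((1 / b) ^ a * Real.Gamma a) := by
  rw [← Real.integral_rpow_mul_exp_neg_mul_Ioi ha hb]
  refine lintegral_ofReal_of_integral_pos ?_ ?_
  · filter_upwards [ae_restrict_mem measurableSet_Ioi] with t ht
    have : (0 : ℝ) < t := ht
    simp only [Pi.zero_apply]; positivity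
  · rw [Real.integral_rpow_mul_exp_neg_mul_Ioi ha hb]
    have := Real.Gamma_pos_of_pos ha
    positivity

theorem lintegral_Ioi_comp_mul (f : ℝ → ℝ≥0∞) {c : ℝ} (hc : 0 < c) :
    ∫⁻ x in Set.Ioi (0 : ℝ), f x = ∫⁻ x in Set.Ioi (0 : ℝ), ENNReal.ofReal c * f (c * x) := by
  have := lintegral_image_eq_lintegral_abs_deriv_mul (s := Set.Ioi (0 : ℝ)) (f := fun x => c * x)
    (f' := fun _ => c) measurableSet_Ioi
    (fun x _ => by simpa using ((hasDerivAt_id x).const_mul c).hasDerivWithinAt)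
    (fun x _ y _ h => by simpa [hc.ne'] using h) f
  rw [Set.image_mul_left_Ioi hc, mul_zero, abs_of_pos hc] at this
  exact this

theorem lintegral_Ioi_comp_inv (f : ℝ → ℝ≥0∞) :
    ∫⁻ x in Set.Ioi (0 : ℝ), f x
      = ∫⁻ x in Set.Ioi (0 : ℝ), ENNReal.ofReal (x ^ (-2 : ℝ)) * f x⁻¹ := by
  have himg : (fun x : ℝ => x⁻¹) '' Set.Ioi 0 = Set.Ioi 0 := by
    ext x
    constructor
    · rintro ⟨y, hy, rfl⟩; exact inv_pos.2 (Set.mem_Ioi.1 hy)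
    · intro hx; exact ⟨x⁻¹, inv_pos.2 (Set.mem_Ioi.1 hx), inv_inv x⟩
  have := lintegral_image_eq_lintegral_abs_deriv_mul (s := Set.Ioi (0 : ℝ)) (f := fun x => x⁻¹)
    (f' := fun x => -(x ^ 2)⁻¹) measurableSet_Ioi
    (fun x hx => (hasDerivAt_inv (ne_of_gt hx)).hasDerivWithinAt)
    (fun x _ y _ h => by simpa using h) f
  rw [himg] at this
  rw [this]
  refine setLIntegral_congr_fun measurableSet_Ioi fun x hx => ?_
  have hx' : (0 : ℝ) < x := hx
  rw [abs_neg, abs_of_pos (by positivity), Real.rpow_neg hx'.le]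
  norm_num

theorem lintegral_invGamma {e A : ℝ} (he : 0 < e) (hA : 0 < A) :
    ∫⁻ w in Set.Ioi (0 : ℝ), ENNReal.ofReal (w ^ (-e - 1) * Real.exp (-(A / w)))
      = ENNReal.ofReal (A ^ (-e) * Real.Gamma e) := by
  rw [lintegral_Ioi_comp_inv]
  have h := lintegral_gamma he hA
  rw [one_div, Real.inv_rpow hA.le, ← Real.rpow_neg hA.le] at h
  rw [← h]
  refine setLIntegral_congr_fun measurableSet_Ioi fun x hx => ?_
  have hx' : (0 : ℝ) < x := hx
  rw [← ENNReal.ofReal_mul (by positivity), Real.inv_rpow hx'.le, ← Real.rpow_neg hx'.le,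
    ← mul_assoc, ← Real.rpow_add hx', div_inv_eq_mul]
  ring_nf

theorem lintegral_gaussian_translate {b : ℝ} (hb : 0 < b) (m : ℝ) :
    ∫⁻ μ : ℝ, ENNReal.ofReal (Real.exp (-b * (m - μ) ^ 2)) = ENNReal.ofReal (√(Real.pi / b)) := by
  rw [lintegral_sub_left_eq_self (fun x => ENNReal.ofReal (Real.exp (-b * x ^ 2))) m,
    ← integral_gaussian]
  refine lintegral_ofReal_of_integral_pos (ae_of_all _ fun x => (Real.exp_pos _).le) ?_
  rw [integral_gaussian]
  positivity

/-- The joint integral over the mean and the scale that is common to both marginal likelihoods. -/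
theorem lintegral_normal_invGamma {e W N : ℝ} (m : ℝ) (he : 1 / 2 < e) (hW : 0 < W) (hN : 0 < N) :
    ∫⁻ μ : ℝ, ∫⁻ w in Set.Ioi (0 : ℝ), ENNReal.ofReal
        (w ^ (-e - 1) * Real.exp (-((W + N * (m - μ) ^ 2) / (2 * w))))
      = ENNReal.ofReal (√(2 * Real.pi / N) * ((W / 2) ^ (-(e - 1 / 2)) * Real.Gamma (e - 1 / 2))) := by
  -- Integrating out μ first gives a Gaussian integral proportional to w^(1/2), which lowers the
  -- inverse-gamma exponent from e to e - 1/2.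
  rw [lintegral_lintegral_swap (by fun_prop)]
  rw [ENNReal.ofReal_mul (by positivity), ← lintegral_invGamma (by linarith) (by positivity),
    ← lintegral_const_mul' _ _ ENNReal.ofReal_ne_top]
  refine setLIntegral_congr_fun measurableSet_Ioi fun w hw => ?_
  have hw' : (0 : ℝ) < w := hw
  have h1 : ∀ μ : ℝ, ENNReal.ofReal (w ^ (-e - 1) * Real.exp (-((W + N * (m - μ) ^ 2) / (2 * w))))
      = ENNReal.ofReal (w ^ (-e - 1) * Real.exp (-(W / 2 / w))) *
        ENNReal.ofReal (Real.exp (-(N / (2 * w)) * (m - μ) ^ 2)) := by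
    intro μ
    rw [← ENNReal.ofReal_mul (by positivity), mul_assoc, ← Real.exp_add]
    congr 3
    field_simp; ring
  simp_rw [h1]
  rw [lintegral_const_mul' _ _ ENNReal.ofReal_ne_top, lintegral_gaussian_translate (by positivity),
    ← ENNReal.ofReal_mul (by positivity), ← ENNReal.ofReal_mul (by positivity)]
  congr 1
  have h2 : √(Real.pi / (N / (2 * w))) = √(2 * Real.pi / N) * w ^ (1 / 2 : ℝ) := by
    rw [← Real.sqrt_eq_rpow, ← Real.sqrt_mul (by positivity)]
    congr 1; field_simp
  rw [h2]
  have h3 : w ^ (-(e - 1 / 2) - 1) = w ^ (-e - 1) * w ^ (1 / 2 : ℝ) := by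
    rw [← Real.rpow_add hw']; ring_nf
  rw [h3]; ring

end

section

variable {p r : ℕ}

/-! ### The marginal likelihoods in closed form -/

theorem marginal0_eq (hp : 2 ≤ p) (hr : 2 ≤ r) {c : ℝ} (hc : 0 < c) (Y : Fin p → Fin r → ℝ)
    (hW : 0 < totalSS Y) :
    marginal0 c Y = ENNReal.ofReal ((2 * Real.pi) ^ (-((p : ℝ) * r) / 2) * c *
      (√(2 * Real.pi / (p * r)) *
        ((totalSS Y / 2) ^ (-((p : ℝ) * r / 2 - 1 / 2)) * Real.Gamma ((p : ℝ) * r / 2 - 1 / 2)))) := by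
  have hp' : (2 : ℝ) ≤ p := by exact_mod_cast hp
  have hr' : (2 : ℝ) ≤ r := by exact_mod_cast hr
  have hpr : (4 : ℝ) ≤ p * r := by nlinarith
  rw [ENNReal.ofReal_mul (by positivity),
    ← lintegral_normal_invGamma (grandMean Y) (by linarith) hW (by positivity),
    ← lintegral_const_mul' _ _ ENNReal.ofReal_ne_top]
  refine lintegral_congr fun μ => ?_
  rw [← lintegral_const_mul' _ _ ENNReal.ofReal_ne_top]
  refine setLIntegral_congr_fun measurableSet_Ioi fun s hs => ?_
  have hs' : (0 : ℝ) < s := hs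
  rw [← ENNReal.ofReal_mul (by positivity), likelihood_eq (by lia) (by lia) Y μ s 0 hs' le_rfl,
    prior0, totalSS_eq (by lia)]
  congr 1
  have h1 : s ^ (-((p : ℝ) * r / 2) - 1)
      = s ^ (-((p : ℝ) * (r - 1) / 2)) * s ^ (-((p : ℝ) / 2)) * s⁻¹ := by
    rw [← Real.rpow_neg_one s, ← Real.rpow_add hs', ← Real.rpow_add hs']; ring_nf
  rw [mul_zero, add_zero, h1]
  have h2 : -((withinSS Y / s + (betweenSS Y + p * r * (grandMean Y - μ) ^ 2) / s) / 2)
      = -((withinSS Y + betweenSS Y + p * r * (grandMean Y - μ) ^ 2) / (2 * s)) := by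
    field_simp; ring
  rw [h2]; ring

/-- The integral over the variances, in the coordinates `t = r σa² / σ²`, `w = σ² + r σa²`. -/
theorem lintegral_variances {a b β E H : ℝ} (hE : 0 < E) (hβ : -1 < β) :
    ∫⁻ s in Set.Ioi (0 : ℝ), ∫⁻ t in Set.Ioi (0 : ℝ), ENNReal.ofReal
        (s ^ (-a - b - 1) * (1 + t) ^ (-a - b) * t ^ β *
          Real.exp (-((E + H / (1 + t)) / (2 * s))))
      = ENNReal.ofReal ((2 / E) ^ (β + 1) * Real.Gamma (β + 1)) *
        ∫⁻ w in Set.Ioi (0 : ℝ), ENNReal.ofReal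
          (w ^ (-(a + b - β - 1) - 1) * Real.exp (-((E + H) / (2 * w)))) := by
  rw [lintegral_lintegral_swap (by fun_prop)]
  have h1 : ∀ t ∈ Set.Ioi (0 : ℝ), ∫⁻ s in Set.Ioi (0 : ℝ), ENNReal.ofReal
        (s ^ (-a - b - 1) * (1 + t) ^ (-a - b) * t ^ β *
          Real.exp (-((E + H / (1 + t)) / (2 * s))))
      = ∫⁻ w in Set.Ioi (0 : ℝ), ENNReal.ofReal
        (w ^ (-a - b - 1) * t ^ β * Real.exp (-((E + H + E * t) / (2 * w)))) := by
    intro t ht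
    have ht' : (0 : ℝ) < t := ht
    -- At fixed t, the substitution s = w/(1 + t) cancels every power of 1 + t and makes the
    -- exponent affine in t, so that the t-integral becomes a Gamma integral.
    rw [lintegral_Ioi_comp_mul _ (c := (1 + t)⁻¹) (by positivity)]
    refine setLIntegral_congr_fun measurableSet_Ioi fun w hw => ?_
    have hw' : (0 : ℝ) < w := hw
    rw [← ENNReal.ofReal_mul (by positivity), Real.mul_rpow (by positivity) hw'.le,
      Real.inv_rpow (by positivity), ← Real.rpow_neg (by positivity)]
    congr 1
    have h2 : (1 + t) ^ (-(-a - b - 1)) = ((1 + t) ^ (-a - b))⁻¹ * (1 + t) := by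
      rw [← Real.rpow_neg (by positivity)]
      nth_rewrite 3 [← Real.rpow_one (1 + t)]
      rw [← Real.rpow_add (by positivity)]; ring_nf
    have h3 : (E + H / (1 + t)) / (2 * ((1 + t)⁻¹ * w)) = (E + H + E * t) / (2 * w) := by
      field_simp; ring
    have h4 : (1 + t) ^ (-a - b) ≠ 0 := by positivity
    rw [h2, h3]
    field_simp
  rw [setLIntegral_congr_fun measurableSet_Ioi h1, lintegral_lintegral_swap (by fun_prop),
    ← lintegral_const_mul' _ _ ENNReal.ofReal_ne_top]
  refine setLIntegral_congr_fun measurableSet_Ioi fun w hw => ?_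
  have hw' : (0 : ℝ) < w := hw
  have h5 : ∀ t : ℝ, ENNReal.ofReal
        (w ^ (-a - b - 1) * t ^ β * Real.exp (-((E + H + E * t) / (2 * w))))
      = ENNReal.ofReal (w ^ (-a - b - 1) * Real.exp (-((E + H) / (2 * w)))) *
        ENNReal.ofReal (t ^ (β + 1 - 1) * Real.exp (-(E / (2 * w) * t))) := by
    intro t
    rw [← ENNReal.ofReal_mul (by positivity)]
    have : Real.exp (-((E + H + E * t) / (2 * w)))
        = Real.exp (-((E + H) / (2 * w))) * Real.exp (-(E / (2 * w) * t)) := by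
      rw [← Real.exp_add]; congr 1; ring
    rw [this, add_sub_cancel_right]; ring_nf
  simp_rw [h5]
  have hG := Real.Gamma_pos_of_pos (show 0 < β + 1 by linarith)
  rw [lintegral_const_mul' _ _ ENNReal.ofReal_ne_top,
    lintegral_gamma (by linarith) (by positivity), ← ENNReal.ofReal_mul (by positivity),
    ← ENNReal.ofReal_mul (by positivity)]
  congr 1
  have h6 : (1 / (E / (2 * w))) ^ (β + 1) = (2 / E) ^ (β + 1) * w ^ (β + 1) := by
    rw [← Real.mul_rpow (by positivity) hw'.le]; congr 1; field_simp
  have h7 : w ^ (-(a + b - β - 1) - 1) = w ^ (-a - b - 1) * w ^ (β + 1) := by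
    rw [← Real.rpow_add hw']; ring_nf
  rw [h6, h7]; ring

theorem marginal1_eq (hp : 2 ≤ p) (hr : 2 ≤ r) {α c : ℝ} (hα : -1 < α) (hc : 0 < c)
    (hβ : -1 < shapeBeta p r α) (Y : Fin p → Fin r → ℝ) (hE : 0 < withinSS Y) :
    marginal1 α c Y = ENNReal.ofReal ((2 * Real.pi) ^ (-((p : ℝ) * r) / 2) * c /
        ProbabilityTheory.beta (α + 1) (shapeBeta p r α + 1) *
      ((2 / withinSS Y) ^ (shapeBeta p r α + 1) * Real.Gamma (shapeBeta p r α + 1)) *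
      (√(2 * Real.pi / (p * r)) *
        ((totalSS Y / 2) ^ (-((p : ℝ) / 2 + α + 1 / 2)) * Real.Gamma ((p : ℝ) / 2 + α + 1 / 2)))) := by
  have hp' : (2 : ℝ) ≤ p := by exact_mod_cast hp
  have hr' : (2 : ℝ) ≤ r := by exact_mod_cast hr
  have hpr : (4 : ℝ) ≤ p * r := by nlinarith
  have hB : 0 < ProbabilityTheory.beta (α + 1) (shapeBeta p r α + 1) :=
    beta_pos (by linarith) (by linarith)
  have hH := betweenSS_nonneg Y
  have hT := totalSS_eq (show r ≠ 0 by lia) Y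
  have hW : 0 < totalSS Y := by linarith
  set β := shapeBeta p r α with hβdef
  -- This identity is the reason for the choice of β: the prior's power of 1 + t combines with that
  -- of the likelihood into exactly the form cancelled in `lintegral_variances`.
  have hβ' : (p : ℝ) * (r - 1) / 2 = α + β + 2 := by rw [hβdef, shapeBeta]; ring
  have hG := Real.Gamma_pos_of_pos (show 0 < β + 1 by linarith)
  have hexp : (p : ℝ) * (r - 1) / 2 + (p : ℝ) / 2 - β - 1 = (p : ℝ) / 2 + α + 1 := by
    rw [hβ']; ring
  have hlast := lintegral_normal_invGamma (e := (p : ℝ) / 2 + α + 1) (W := totalSS Y)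
    (N := p * r) (grandMean Y) (by linarith) hW (by positivity)
  rw [show (p : ℝ) / 2 + α + 1 - 1 / 2 = p / 2 + α + 1 / 2 by ring] at hlast
  rw [ENNReal.ofReal_mul (by positivity), ← hlast, ← lintegral_const_mul' _ _ ENNReal.ofReal_ne_top]
  refine lintegral_congr fun μ => ?_
  rw [ENNReal.ofReal_mul (by positivity), mul_assoc]
  have hv := lintegral_variances (a := (p : ℝ) * (r - 1) / 2) (b := (p : ℝ) / 2)
    (H := betweenSS Y + p * r * (grandMean Y - μ) ^ 2) hE hβ
  rw [hexp, ← add_assoc, ← hT] at hv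
  rw [← hv, ← lintegral_const_mul' _ _ ENNReal.ofReal_ne_top]
  refine setLIntegral_congr_fun measurableSet_Ioi fun s hs => ?_
  have hs' : (0 : ℝ) < s := hs
  rw [← lintegral_const_mul' _ _ ENNReal.ofReal_ne_top,
    lintegral_Ioi_comp_mul _ (c := s / r) (by positivity)]
  refine setLIntegral_congr_fun measurableSet_Ioi fun t ht => ?_
  have ht' : (0 : ℝ) < t := ht
  have hq : (0 : ℝ) < s / r * t / s := by positivity
  rw [← ENNReal.ofReal_mul (by positivity), ← ENNReal.ofReal_mul (by positivity),
    likelihood_eq (by lia) (by lia) Y μ s _ hs' (by positivity),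
    prior1, prior0, pearsonVI, Set.indicator_of_mem (show s / r * t / s ∈ Set.Ioi (0 : ℝ) from hq),
    ← hβdef]
  have e1 : (r : ℝ) * (s / r * t / s) = t := by field_simp
  have e2 : s + r * (s / r * t) = s * (1 + t) := by field_simp
  rw [e1, e2]
  congr 1
  have e3 : withinSS Y / s + (betweenSS Y + p * r * (grandMean Y - μ) ^ 2) / (s * (1 + t))
      = (withinSS Y + (betweenSS Y + p * r * (grandMean Y - μ) ^ 2) / (1 + t)) / s := by
    field_simp
  have e4 : (s * (1 + t)) ^ (-((p : ℝ) / 2)) = s ^ (-((p : ℝ) / 2)) * (1 + t) ^ (-((p : ℝ) / 2)) :=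
    Real.mul_rpow hs'.le (by positivity)
  have e5 : s ^ (-((p : ℝ) * (r - 1) / 2) - (p : ℝ) / 2 - 1)
      = s ^ (-((p : ℝ) * (r - 1) / 2)) * s ^ (-((p : ℝ) / 2)) * s⁻¹ := by
    rw [← Real.rpow_neg_one s, ← Real.rpow_add hs', ← Real.rpow_add hs']; ring_nf
  have e6 : (1 + t) ^ (-((p : ℝ) * (r - 1) / 2) - (p : ℝ) / 2)
      = (1 + t) ^ (-α - β - 2) * (1 + t) ^ (-((p : ℝ) / 2)) := by
    rw [← Real.rpow_add (by positivity), hβ']; ring_nf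
  rw [e3, e4, e5, e6, div_div _ s 2, mul_comm s 2]
  field_simp

theorem bayesFactor_eq_closedBF (hp : 2 ≤ p) (hr : 2 ≤ r) {α c : ℝ} (hα : -1 < α) (hc : 0 < c)
    (hβ : -1 < shapeBeta p r α) (Y : Fin p → Fin r → ℝ) (hE : 0 < withinSS Y) :
    bayesFactor α c Y = ENNReal.ofReal (closedBF α Y) := by
  have hp' : (2 : ℝ) ≤ p := by exact_mod_cast hp
  have hr' : (2 : ℝ) ≤ r := by exact_mod_cast hr
  have hpr : (4 : ℝ) ≤ p * r := by nlinarith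
  have hW : 0 < totalSS Y := by
    have := betweenSS_nonneg Y
    rw [totalSS_eq (show r ≠ 0 by lia) Y]; linarith
  have hG0 := Real.Gamma_pos_of_pos (show 0 < (p : ℝ) * r / 2 - 1 / 2 by linarith)
  rw [bayesFactor, marginal0_eq hp hr hc Y hW, marginal1_eq hp hr hα hc hβ Y hE,
    ← ENNReal.ofReal_div_of_pos (by positivity)]
  congr 1
  -- The normalising Beta function thus has Γ((n-p)/2) in its denominator. Its Γ(β+1) cancels
  -- against the one from the t-integral.
  have hβ' : α + 1 + (shapeBeta p r α + 1) = ((p : ℝ) * r - p) / 2 := by rw [shapeBeta]; ring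
  have hG1 := Real.Gamma_pos_of_pos (show 0 < shapeBeta p r α + 1 by linarith)
  have hG2 := Real.Gamma_pos_of_pos (show 0 < α + 1 by linarith)
  have hG3 := Real.Gamma_pos_of_pos (show 0 < ((p : ℝ) * r - p) / 2 by rw [← hβ']; linarith)
  rw [closedBF, ProbabilityTheory.beta, hβ',
    show ((p : ℝ) * r - 1) / 2 = (p : ℝ) * r / 2 - 1 / 2 by ring,
    show -((p : ℝ) * r - p - 2) / 2 + α = -(shapeBeta p r α + 1) by rw [shapeBeta]; ring]
  have e1 : (totalSS Y / 2) ^ (-((p : ℝ) * r / 2 - 1 / 2))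
      = (totalSS Y / 2) ^ (-((p : ℝ) / 2 + α + 1 / 2)) *
        ((totalSS Y / 2) ^ (shapeBeta p r α + 1))⁻¹ := by
    rw [← Real.rpow_neg (by positivity), ← Real.rpow_add (by positivity), shapeBeta]; ring_nf
  have e2 : (withinSS Y / totalSS Y) ^ (-(shapeBeta p r α + 1))
      = (2 / withinSS Y) ^ (shapeBeta p r α + 1) * (totalSS Y / 2) ^ (shapeBeta p r α + 1) := by
    rw [← Real.mul_rpow (by positivity) (by positivity), Real.rpow_neg (by positivity),
      ← Real.inv_rpow (by positivity)]
    congr 1; field_simp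
  rw [e1, e2]
  field_simp

end

/-! ### Crude Stirling bounds for the Gamma function -/

/-- The leading part of `log Γ`. -/
noncomputable def stirlingMain (x : ℝ) : ℝ := x * Real.log x - x

theorem one_div_add_one_le_log_sub {x : ℝ} (hx : 0 < x) :
    1 / (x + 1) ≤ Real.log (x + 1) - Real.log x := by
  have h := Real.log_le_sub_one_of_pos (show 0 < x / (x + 1) by positivity)
  rw [Real.log_div hx.ne' (by positivity)] at h
  have : x / (x + 1) = 1 - 1 / (x + 1) := by field_simp; ring
  linarith

theorem log_sub_le_one_div {x : ℝ} (hx : 0 < x) :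
    Real.log (x + 1) - Real.log x ≤ 1 / x := by
  have h := Real.log_le_sub_one_of_pos (show 0 < (x + 1) / x by positivity)
  rw [Real.log_div (by positivity) hx.ne'] at h
  have : (x + 1) / x = 1 + 1 / x := by field_simp
  linarith

theorem log_Gamma_sub_stirlingMain_add_one {x : ℝ} (hx : 0 < x) :
    Real.log (Real.Gamma (x + 1)) - stirlingMain (x + 1)
      = Real.log (Real.Gamma x) - stirlingMain x + 1
        - (x + 1) * (Real.log (x + 1) - Real.log x) := by
  rw [Real.Gamma_add_one hx.ne', Real.log_mul hx.ne' (Real.Gamma_pos_of_pos hx).ne',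
    stirlingMain, stirlingMain]
  ring

/-- Let D = log Γ - `stirlingMain`. Under x ↦ x + 1, D does not increase, and it drops by at most
log(x+1) - log x, so D + 3 log x does not decrease. Compactness bounds both on [1/2, 3/2] and
induction carries the bounds to the right. The coefficient 3 is generous. -/
theorem exists_log_Gamma_bounds : ∃ C : ℝ, ∀ x : ℝ, 1 / 2 ≤ x →
    Real.log (Real.Gamma x) - stirlingMain x ≤ C ∧
    -C ≤ Real.log (Real.Gamma x) - stirlingMain x + 3 * Real.log x := by
  have hcont : ContinuousOn Real.Gamma (Set.Icc (1 / 2) (3 / 2)) := fun x hx =>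
    (Real.differentiableAt_Gamma fun m => by
      have := hx.1; have : (0 : ℝ) ≤ m := m.cast_nonneg; intro h; linarith).continuousAt.continuousWithinAt
  have hpos : ∀ x ∈ Set.Icc (1 / 2 : ℝ) (3 / 2), x ≠ 0 := fun x hx => by
    have := hx.1; intro h; linarith
  have hf : ContinuousOn (fun x => Real.log (Real.Gamma x) - stirlingMain x)
      (Set.Icc (1 / 2) (3 / 2)) := by
    unfold stirlingMain
    refine (hcont.log fun x hx => ?_).sub ((continuousOn_id.mul (continuousOn_id.log hpos)).sub
      continuousOn_id)
    exact (Real.Gamma_pos_of_pos (by have := hx.1; linarith)).ne'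
  obtain ⟨C1, h1⟩ := isCompact_Icc.exists_bound_of_continuousOn hf
  obtain ⟨C2, h2⟩ := isCompact_Icc.exists_bound_of_continuousOn
    (hf.add ((continuousOn_id.log hpos).const_mul 3))
  have key : ∀ n : ℕ, ∀ x ∈ Set.Icc (1 / 2 : ℝ) (3 / 2),
      Real.log (Real.Gamma (x + n)) - stirlingMain (x + n) ≤ max C1 C2 ∧
      -max C1 C2 ≤ Real.log (Real.Gamma (x + n)) - stirlingMain (x + n)
        + 3 * Real.log (x + n) := by
    intro n
    induction n with
    | zero =>
      intro x hx
      have a := abs_le.1 (h1 x hx)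
      have b := abs_le.1 (h2 x hx)
      simp only [id, Pi.add_apply] at b
      simp only [Nat.cast_zero, add_zero]
      exact ⟨a.2.trans (le_max_left _ _), by linarith [b.1, le_max_right C1 C2]⟩
    | succ n ih =>
      intro x hx
      obtain ⟨a, b⟩ := ih x hx
      have hx2 : 1 / 2 ≤ x + n := by have := hx.1; have : (0 : ℝ) ≤ n := n.cast_nonneg; linarith
      have hx0 : 0 < x + n := by linarith
      have c := one_div_add_one_le_log_sub hx0
      have d := log_sub_le_one_div hx0
      have e := log_Gamma_sub_stirlingMain_add_one hx0
      rw [Nat.cast_succ, ← add_assoc, e]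
      generalize x + (n : ℝ) = y at *
      have c' : 1 ≤ (y + 1) * (Real.log (y + 1) - Real.log y) := by
        rwa [div_le_iff₀' (by linarith)] at c
      have d' : y * (Real.log (y + 1) - Real.log y) ≤ 1 := by rwa [le_div_iff₀' hx0] at d
      refine ⟨by linarith, ?_⟩
      have f : 0 ≤ Real.log (y + 1) - Real.log y := (by positivity : 0 ≤ 1 / (y + 1)).trans c
      nlinarith
  refine ⟨max C1 C2, fun x hx => ?_⟩
  have h0 : 0 ≤ x - 1 / 2 := by linarith
  have := key ⌊x - 1 / 2⌋₊ (x - ⌊x - 1 / 2⌋₊)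
    ⟨by linarith [Nat.floor_le h0], by linarith [Nat.lt_floor_add_one (x - 1 / 2)]⟩
  simpa using this

/-- `stirlingMain` is convex with derivative log; this is its tangent-line inequality at x. -/
theorem stirlingMain_sub_le {x y : ℝ} (hx : 0 < x) (hy : 0 < y) :
    stirlingMain x - stirlingMain y ≤ Real.log x * (x - y) := by
  have h := Real.log_le_sub_one_of_pos (show 0 < x / y by positivity)
  rw [Real.log_div hx.ne' hy.ne'] at h
  have : y * (Real.log x - Real.log y) ≤ y * (x / y - 1) := mul_le_mul_of_nonneg_left h hy.le
  rw [mul_sub, mul_sub, mul_div_cancel₀ _ hy.ne'] at this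
  unfold stirlingMain; nlinarith

theorem abs_stirlingMain_sub_le {x y L : ℝ} (hx : 0 < x) (hy : 0 < y) (hxL : |Real.log x| ≤ L)
    (hyL : |Real.log y| ≤ L) : |stirlingMain x - stirlingMain y| ≤ L * |x - y| := by
  have h1 := stirlingMain_sub_le hx hy
  have h2 := stirlingMain_sub_le hy hx
  have h3 : Real.log x * (x - y) ≤ L * |x - y| :=
    (le_abs_self _).trans (by rw [abs_mul]; gcongr)
  have h4 : Real.log y * (y - x) ≤ L * |x - y| :=
    (le_abs_self _).trans (by rw [abs_mul, abs_sub_comm y x]; gcongr)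
  rw [abs_le]; constructor <;> linarith

/-- The Gamma factor of the closed-form Bayes factor. -/
noncomputable def gammaFactor (p r : ℕ) (α : ℝ) : ℝ :=
  Real.Gamma ((p : ℝ) / 2 + α + 1 / 2) * Real.Gamma (((p : ℝ) * r - p) / 2) /
      (Real.Gamma (((p : ℝ) * r - 1) / 2) * Real.Gamma (α + 1))

/-- The rate `r log r - (r - 1) log (r - 1)` at which the Gamma factor decays. -/
noncomputable def gammaRate (r : ℕ) : ℝ :=
  r * Real.log r - (r - 1) * Real.log (r - 1)

theorem gammaFactor_pos {p r : ℕ} (hp : 2 ≤ p) (hr : 2 ≤ r) {α : ℝ} (hα : -1 < α) :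
    0 < gammaFactor p r α := by
  have hp' : (2 : ℝ) ≤ p := by exact_mod_cast hp
  have hr' : (2 : ℝ) ≤ r := by exact_mod_cast hr
  have h1 := Real.Gamma_pos_of_pos (show 0 < (p : ℝ) / 2 + α + 1 / 2 by linarith)
  have h2 := Real.Gamma_pos_of_pos (show 0 < ((p : ℝ) * r - p) / 2 by nlinarith)
  have h3 := Real.Gamma_pos_of_pos (show 0 < ((p : ℝ) * r - 1) / 2 by nlinarith)
  have h4 := Real.Gamma_pos_of_pos (show 0 < α + 1 by linarith)
  unfold gammaFactor; positivity

theorem gammaRate_le {r : ℕ} (hr : 2 ≤ r) : gammaRate r ≤ Real.log r + 1 := by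
  have hr' : (2 : ℝ) ≤ r := by exact_mod_cast hr
  have := log_sub_le_one_div (show 0 < (r : ℝ) - 1 by linarith)
  rw [le_div_iff₀' (by linarith), sub_add_cancel] at this
  unfold gammaRate; nlinarith

theorem one_le_log_mul {p r : ℕ} (hp : 2 ≤ p) (hr : 2 ≤ r) : 1 ≤ Real.log ((p : ℝ) * r) := by
  have hp' : (2 : ℝ) ≤ p := by exact_mod_cast hp
  have hr' : (2 : ℝ) ≤ r := by exact_mod_cast hr
  rw [Real.le_log_iff_exp_le (by positivity)]
  have := Real.exp_one_lt_d9
  nlinarith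

/-- Up to shifts by α + 1/2 and -1/2, which cost O(log(pr)), the Gamma arguments are p/2, p(r-1)/2
and pr/2. Since 1 + (r-1) - r = 0, the log(p/2) terms and the linear terms of `stirlingMain` cancel
and only `gammaRate` survives. Uniformity in both p and r is what the joint limit needs. -/
theorem exists_abs_log_gammaFactor_add_le {α : ℝ} (hα : -1 < α) :
    ∃ C : ℝ, 0 ≤ C ∧ ∀ p r : ℕ, 2 ≤ p → 2 ≤ r →
      |Real.log (gammaFactor p r α) + (p : ℝ) / 2 * gammaRate r|
        ≤ C * Real.log ((p : ℝ) * r) := by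
  obtain ⟨C, hC⟩ := exists_log_Gamma_bounds
  -- Chosen so that |log x| ≤ A log(pr) for all x between 1/2 and pr(2 + |α|), a range containing
  -- every argument used below.
  set A := 1 + Real.log (2 + |α|) with hA
  have hA0 : 0 ≤ Real.log (2 + |α|) := Real.log_nonneg (by have := abs_nonneg α; linarith)
  -- Three Stirling errors, the two argument shifts (|α| + 1/2 and 1/2), and the constant log
  -- Γ(α+1).
  refine ⟨3 * (|C| + 3 * A) + A * (|α| + 1) + |Real.log (Real.Gamma (α + 1))|, by positivity, ?_⟩
  intro p r hp hr
  have hp' : (2 : ℝ) ≤ p := by exact_mod_cast hp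
  have hr' : (2 : ℝ) ≤ r := by exact_mod_cast hr
  have hpr : (p : ℝ) * 2 ≤ p * r := by gcongr
  set L := Real.log ((p : ℝ) * r) with hL
  have hL1 : 1 ≤ L := one_le_log_mul hp hr
  have hlog : ∀ x : ℝ, 1 / 2 ≤ x → x ≤ p * r * (2 + |α|) → |Real.log x| ≤ A * L := by
    intro x hx hx2
    have h1 : Real.log x ≤ L + Real.log (2 + |α|) := by
      rw [hL, ← Real.log_mul (by positivity) (by positivity)]
      exact Real.log_le_log (by linarith) hx2
    have h2 : -Real.log 2 ≤ Real.log x := by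
      rw [← Real.log_inv]; exact Real.log_le_log (by norm_num) (by linarith)
    have h3 := Real.log_two_lt_d9
    rw [abs_le, hA]
    constructor <;> nlinarith
  have hstir : ∀ x : ℝ, 1 / 2 ≤ x → x ≤ p * r * (2 + |α|) →
      |Real.log (Real.Gamma x) - stirlingMain x| ≤ (|C| + 3 * A) * L := by
    intro x hx hx2
    obtain ⟨a, b⟩ := hC x hx
    have c := abs_le.1 (hlog x hx hx2)
    have d := le_abs_self C
    have e : |C| ≤ |C| * L := le_mul_of_one_le_right (abs_nonneg C) hL1
    have f : 0 ≤ A * L := by positivity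
    rw [abs_le]; constructor <;> linarith [c.1, c.2]
  have habs := abs_nonneg α
  have hle : ∀ x : ℝ, x ≤ (p : ℝ) * r * 2 → x ≤ p * r * (2 + |α|) := fun x hx =>
    hx.trans (by gcongr; linarith)
  have b1 : (p : ℝ) / 2 + α + 1 / 2 ≤ p * r * (2 + |α|) := by
    have := le_abs_self α; nlinarith
  -- With p ≥ 2 and α > -1 only, 1/2 is the best lower bound; hence the range in
  -- `exists_log_Gamma_bounds`.
  have a1 : 1 / 2 ≤ (p : ℝ) / 2 + α + 1 / 2 := by linarith
  have a2 : 1 / 2 ≤ ((p : ℝ) * r - p) / 2 := by linarith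
  have a3 : 1 / 2 ≤ ((p : ℝ) * r - 1) / 2 := by linarith
  have s1 := hstir _ a1 b1
  have s2 := hstir _ a2 (hle _ (by linarith))
  have s3 := hstir _ a3 (hle _ (by linarith))
  have m1 := abs_stirlingMain_sub_le (by linarith) (by linarith) (hlog _ a1 b1)
    (hlog ((p : ℝ) / 2) (by linarith) (hle _ (by linarith)))
  have m3 := abs_stirlingMain_sub_le (by linarith) (by linarith)
    (hlog _ a3 (hle _ (by linarith)))
    (hlog ((p : ℝ) * r / 2) (by linarith) (hle _ (by linarith)))
  have m1' : |(p : ℝ) / 2 + α + 1 / 2 - p / 2| ≤ |α| + 1 / 2 := by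
    rw [show (p : ℝ) / 2 + α + 1 / 2 - p / 2 = α + 1 / 2 by ring]
    exact (abs_add_le _ _).trans (by norm_num)
  have m3' : |((p : ℝ) * r - 1) / 2 - p * r / 2| = 1 / 2 := by
    rw [show ((p : ℝ) * r - 1) / 2 - p * r / 2 = -(1 / 2) by ring, abs_neg]; norm_num
  rw [m3'] at m3
  have hAL : 0 ≤ A * L := by positivity
  have m1'' := m1.trans (mul_le_mul_of_nonneg_left m1' hAL)
  have hmain : stirlingMain ((p : ℝ) / 2) + stirlingMain (((p : ℝ) * r - p) / 2)
      - stirlingMain ((p : ℝ) * r / 2) = -((p : ℝ) / 2 * gammaRate r) := by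
    have e1 : ((p : ℝ) * r - p) / 2 = p / 2 * (r - 1) := by ring
    have e2 : (p : ℝ) * r / 2 = p / 2 * r := by ring
    rw [e1, e2, stirlingMain, stirlingMain, stirlingMain, gammaRate,
      Real.log_mul (by positivity) (by linarith), Real.log_mul (by positivity) (by positivity)]
    ring
  have g1 := (Real.Gamma_pos_of_pos (show 0 < (p : ℝ) / 2 + α + 1 / 2 by linarith)).ne'
  have g2 := (Real.Gamma_pos_of_pos (show 0 < ((p : ℝ) * r - p) / 2 by linarith)).ne'
  have g3 := (Real.Gamma_pos_of_pos (show 0 < ((p : ℝ) * r - 1) / 2 by linarith)).ne'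
  have g4 := (Real.Gamma_pos_of_pos (show 0 < α + 1 by linarith)).ne'
  rw [gammaFactor, Real.log_div (mul_ne_zero g1 g2) (mul_ne_zero g3 g4), Real.log_mul g1 g2,
    Real.log_mul g3 g4]
  have hlast : |Real.log (Real.Gamma (α + 1))| ≤ |Real.log (Real.Gamma (α + 1))| * L :=
    le_mul_of_one_le_right (abs_nonneg _) hL1
  rw [abs_le] at s1 s2 s3 m1'' m3 ⊢
  have l1 := le_abs_self (Real.log (Real.Gamma (α + 1)))
  have l2 := neg_abs_le (Real.log (Real.Gamma (α + 1)))
  constructor <;> linarith [s1.1, s1.2, s2.1, s2.2, s3.1, s3.2, m1''.1, m1''.2, m3.1, m3.2]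

/-- By log-convexity the slope of log Γ over [x, x+s] is at least that over [x-1, x], which is
log(x-1); so the ratio is at most (x-1)^(-s). For fixed p this replaces the Stirling bound, whose
O(log r) error is as large as the decay itself. -/
theorem tendsto_Gamma_div_Gamma_add {s : ℝ} (hs : 0 < s) :
    Tendsto (fun x => Real.Gamma x / Real.Gamma (x + s)) atTop (𝓝 0) := by
  have h1 : Tendsto (fun x : ℝ => (x - 1) ^ (-s)) atTop (𝓝 0) :=
    (tendsto_rpow_neg_atTop hs).comp (tendsto_atTop_add_const_right _ _ tendsto_id)
  refine tendsto_of_tendsto_of_tendsto_of_le_of_le' tendsto_const_nhds h1 ?_ ?_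
  · filter_upwards [eventually_gt_atTop 0] with x hx
    have a := Real.Gamma_pos_of_pos hx
    have b := Real.Gamma_pos_of_pos (show 0 < x + s by linarith)
    positivity
  · filter_upwards [eventually_gt_atTop 1] with x hx
    have a := Real.Gamma_pos_of_pos (show 0 < x by linarith)
    have b := Real.Gamma_pos_of_pos (show 0 < x + s by linarith)
    have c := Real.Gamma_pos_of_pos (show 0 < x - 1 by linarith)
    have hc := Real.convexOn_log_Gamma.slope_mono_adjacent (x := x - 1) (y := x) (z := x + s)
      (Set.mem_Ioi.2 (by linarith)) (Set.mem_Ioi.2 (by linarith)) (by linarith) (by linarith)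
    simp only [Function.comp] at hc
    have hG : Real.Gamma x = (x - 1) * Real.Gamma (x - 1) := by
      have := Real.Gamma_add_one (show x - 1 ≠ 0 by linarith)
      rwa [sub_add_cancel] at this
    rw [add_sub_cancel_left, sub_sub_cancel, div_one, le_div_iff₀ hs] at hc
    have hd : Real.log (Real.Gamma x) - Real.log (Real.Gamma (x - 1)) = Real.log (x - 1) := by
      rw [hG, Real.log_mul (by linarith) c.ne']; ring
    rw [hd] at hc
    rw [Real.rpow_def_of_pos (by linarith), ← Real.log_le_iff_le_exp (by positivity),
      Real.log_div a.ne' b.ne']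
    linarith

section

/-! ### Moments of Gaussian squares -/

/-- The variance of the square of a standard Gaussian variable. -/
noncomputable def sqVar : ℝ := Var[fun x => x ^ 2; gaussianReal 0 1]

theorem sqVar_nonneg : 0 ≤ sqVar := variance_nonneg _ _

theorem memLp_sq_gaussianReal (v : ℝ≥0) : MemLp (fun x : ℝ => x ^ 2) 2 (gaussianReal 0 v) := by
  rw [memLp_two_iff_integrable_sq (by fun_prop)]
  have := (memLp_id_gaussianReal (μ := 0) (v := v) 4).integrable_norm_pow (by norm_num)
  refine this.congr (ae_of_all _ fun x => ?_)
  simp only [id, Real.norm_eq_abs]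
  rw [← pow_mul]
  exact (Even.pow_abs (by decide) x)

theorem integral_sq_gaussianReal (v : ℝ≥0) : ∫ x, x ^ 2 ∂gaussianReal 0 v = v := by
  have h := variance_eq_sub (memLp_id_gaussianReal (μ := 0) (v := v) 2)
  rw [variance_id_gaussianReal] at h
  simp only [id, integral_id_gaussianReal, Pi.pow_apply] at h
  rw [h]; simp

theorem variance_sq_gaussianReal (v : ℝ≥0) :
    Var[fun x => x ^ 2; gaussianReal 0 v] = sqVar * (v : ℝ) ^ 2 := by
  have h : gaussianReal 0 v = (gaussianReal 0 1).map (√(v : ℝ) * ·) := by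
    rw [gaussianReal_map_const_mul, mul_zero, mul_one]
    congr 1
    exact NNReal.coe_injective (by simp)
  rw [h, variance_map (by fun_prop) (by fun_prop)]
  have h2 : (fun x : ℝ => x ^ 2) ∘ (fun x => √(v : ℝ) * x) = fun x => (v : ℝ) * x ^ 2 := by
    ext x; simp [mul_pow]
  rw [h2, variance_const_mul, sqVar]; ring

section Law

variable {Ω : Type*} {mΩ : MeasurableSpace Ω} {P : Measure Ω} {X : Ω → ℝ} {v : ℝ≥0}

theorem memLp_sq_of_hasLaw (hX : HasLaw X (gaussianReal 0 v) P) :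
    MemLp (fun ω => X ω ^ 2) 2 P := by
  have h := memLp_sq_gaussianReal v
  rw [← hX.map_eq] at h
  exact h.comp_of_map hX.aemeasurable

theorem integral_sq_of_hasLaw (hX : HasLaw X (gaussianReal 0 v) P) : ∫ ω, X ω ^ 2 ∂P = v := by
  rw [← integral_sq_gaussianReal v]
  exact hX.integral_comp (f := fun x => x ^ 2) (by fun_prop)

theorem variance_sq_of_hasLaw (hX : HasLaw X (gaussianReal 0 v) P) :
    Var[fun ω => X ω ^ 2; P] = sqVar * (v : ℝ) ^ 2 := by
  rw [← variance_sq_gaussianReal v, ← hX.map_eq, variance_map (by fun_prop) hX.aemeasurable]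
  rfl

theorem memLp_of_hasLaw (hX : HasLaw X (gaussianReal 0 v) P) : MemLp X 2 P := by
  have h := memLp_id_gaussianReal (μ := 0) (v := v) 2
  rw [← hX.map_eq] at h
  exact h.comp_of_map hX.aemeasurable

end Law

/-! ### The rows of the data -/

/-- The law of the observations on one unit. -/
noncomputable def rowLaw (r : ℕ) (μ : ℝ) (σa2 σ2 : ℝ≥0) : Measure (Fin r → ℝ) :=
  ((gaussianReal 0 σa2).prod (Measure.pi fun _ : Fin r => gaussianReal 0 σ2)).map
    fun z j => μ + z.1 + z.2 j

theorem measurable_row {r : ℕ} (μ : ℝ) :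
    Measurable fun (z : ℝ × (Fin r → ℝ)) (j : Fin r) => μ + z.1 + z.2 j := by fun_prop

instance isProbabilityMeasure_rowLaw (r : ℕ) (μ : ℝ) (σa2 σ2 : ℝ≥0) :
    IsProbabilityMeasure (rowLaw r μ σa2 σ2) :=
  Measure.isProbabilityMeasure_map (measurable_row μ).aemeasurable

/-- Pairing each random effect with the errors of its unit exhibits the rows as independent and
identically distributed, which reduces all deviation bounds to moments of a single row. -/
theorem dataLaw_eq_pi (p r : ℕ) (μ : ℝ) (σa2 σ2 : ℝ≥0) :
    dataLaw p r μ σa2 σ2 = Measure.pi fun _ : Fin p => rowLaw r μ σa2 σ2 := by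
  have h := measurePreserving_arrowProdEquivProdArrow ℝ (Fin r → ℝ) (Fin p)
    (fun _ => gaussianReal 0 σa2) (fun _ => Measure.pi fun _ : Fin r => gaussianReal 0 σ2)
  rw [dataLaw, ← h.map_eq, Measure.map_map (by fun_prop) h.measurable]
  have : ∀ _ : Fin p, SigmaFinite (((gaussianReal 0 σa2).prod
      (Measure.pi fun _ : Fin r => gaussianReal 0 σ2)).map
        fun (z : ℝ × (Fin r → ℝ)) (j : Fin r) => μ + z.1 + z.2 j) := fun _ =>
    have := isProbabilityMeasure_rowLaw r μ σa2 σ2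
    inferInstanceAs (SigmaFinite (rowLaw r μ σa2 σ2))
  exact Measure.pi_map_pi fun _ : Fin p => (measurable_row μ).aemeasurable

instance isProbabilityMeasure_dataLaw (p r : ℕ) (μ : ℝ) (σa2 σ2 : ℝ≥0) :
    IsProbabilityMeasure (dataLaw p r μ σa2 σ2) := by
  rw [dataLaw_eq_pi]; infer_instance

theorem hasLaw_eval_pi {ι α : Type*} [Fintype ι] [MeasurableSpace α] (ν : Measure α)
    [IsProbabilityMeasure ν] (i : ι) :
    HasLaw (fun x : ι → α => x i) ν (Measure.pi fun _ : ι => ν) :=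
  (measurePreserving_eval (fun _ : ι => ν) i).hasLaw

theorem hasLaw_sum_pi_gaussianReal (r : ℕ) (v : ℝ≥0) :
    HasLaw (fun e : Fin r → ℝ => ∑ j, e j) (gaussianReal 0 (r * v))
      (Measure.pi fun _ : Fin r => gaussianReal 0 v) := by
  have hlaw : ∀ j : Fin r, HasLaw (fun e : Fin r → ℝ => e j) (gaussianReal 0 v)
      (Measure.pi fun _ : Fin r => gaussianReal 0 v) := 
    hasLaw_eval_pi _
  have hind : iIndepFun (fun (j : Fin r) (e : Fin r → ℝ) => e j)
      (Measure.pi fun _ : Fin r => gaussianReal 0 v) :=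
    iIndepFun_pi (X := fun _ x => x) fun _ => aemeasurable_id
  have hG := hind.hasGaussianLaw_fun_sum fun j => (hlaw j).hasGaussianLaw
  refine ⟨by fun_prop, ?_⟩
  rw [hG.map_eq_gaussianReal]
  congr 1
  · rw [integral_finsetSum _ fun j _ => (memLp_of_hasLaw (hlaw j)).integrable one_le_two]
    simp_rw [(hlaw _).integral_eq, integral_id_gaussianReal, Finset.sum_const_zero]
  · have h := variance_sum_pi (μ := fun _ : Fin r => gaussianReal 0 v) (X := fun _ x => x)
      fun _ => memLp_id_gaussianReal 2
    have h2 : (∑ i : Fin r, fun ω : Fin r → ℝ => ω i) = fun ω => ∑ i, ω i := by ext; simp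
    rw [h2] at h
    rw [h]
    simp only [variance_fun_id_gaussianReal, Finset.sum_const, Finset.card_univ, Fintype.card_fin,
      nsmul_eq_mul]
    exact NNReal.coe_injective (by rw [Real.coe_toNNReal _ (by positivity)]; push_cast; rfl)

theorem hasLaw_rowMean {r : ℕ} (hr : r ≠ 0) (μ : ℝ) (σa2 σ2 : ℝ≥0) :
    HasLaw (fun y : Fin r → ℝ => (∑ j, y j) / r - μ) (gaussianReal 0 (σa2 + σ2 / r))
      (rowLaw r μ σa2 σ2) := by
  have hr' : (r : ℝ) ≠ 0 := by exact_mod_cast hr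
  refine ⟨by fun_prop, ?_⟩
  rw [rowLaw, Measure.map_map (by fun_prop) (measurable_row μ)]
  have hcomp : (fun y : Fin r → ℝ => (∑ j, y j) / r - μ) ∘
      (fun (z : ℝ × (Fin r → ℝ)) (j : Fin r) => μ + z.1 + z.2 j)
      = (fun x : ℝ × ℝ => x.1 + x.2) ∘
        Prod.map id (fun e : Fin r → ℝ => (r : ℝ)⁻¹ * ∑ j, e j) := by
    ext z
    simp [Finset.sum_add_distrib]
    field_simp; ring
  have hmean := gaussianReal_const_mul (hasLaw_sum_pi_gaussianReal r σ2) (r : ℝ)⁻¹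
  rw [hcomp, ← Measure.map_map (by fun_prop) (by fun_prop),
    ← Measure.map_prod_map _ _ measurable_id (by fun_prop), Measure.map_id, hmean.map_eq]
  change (gaussianReal 0 σa2) ∗ _ = _
  rw [gaussianReal_conv_gaussianReal, mul_zero, add_zero]
  congr 1
  refine NNReal.coe_injective ?_
  push_cast
  field_simp

theorem hasLaw_scaledRowMean {r : ℕ} (hr : r ≠ 0) (μ : ℝ) (σa2 σ2 : ℝ≥0) :
    HasLaw (fun y : Fin r → ℝ => √(r : ℝ) * ((∑ j, y j) / r - μ))
      (gaussianReal 0 (σ2 + r * σa2)) (rowLaw r μ σa2 σ2) := by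
  have hr' : (r : ℝ) ≠ 0 := by exact_mod_cast hr
  have h := gaussianReal_const_mul (hasLaw_rowMean hr μ σa2 σ2) (√(r : ℝ))
  rw [mul_zero] at h
  convert h using 2
  refine NNReal.coe_injective ?_
  push_cast
  rw [Real.sq_sqrt (by positivity)]
  field_simp; ring

theorem variance_sub_le {Ω : Type*} {mΩ : MeasurableSpace Ω} {P : Measure Ω} [IsFiniteMeasure P]
    {X Y : Ω → ℝ} (hX : MemLp X 2 P) (hY : MemLp Y 2 P) :
    Var[X - Y; P] ≤ 2 * Var[X; P] + 2 * Var[Y; P] := by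
  have h1 := variance_add hX hY
  have h2 := variance_nonneg (X + Y) P
  rw [variance_sub hX hY]; linarith

/-- The sum of squares about the mean. -/
noncomputable def rowSS {r : ℕ} (y : Fin r → ℝ) : ℝ := ∑ j, (y j - (∑ k, y k) / r) ^ 2

theorem measurable_rowSS {r : ℕ} : Measurable (rowSS : (Fin r → ℝ) → ℝ) := by
  unfold rowSS; fun_prop

theorem rowSS_eq {r : ℕ} (hr : r ≠ 0) (y : Fin r → ℝ) :
    rowSS y = ∑ j, y j ^ 2 - (√(r : ℝ) * ((∑ k, y k) / r)) ^ 2 := by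
  have : NeZero r := ⟨hr⟩
  have h := sum_sub_sq_eq Finset.univ y 0 Finset.univ_nonempty
  simp only [sub_zero, Finset.card_univ, Fintype.card_fin] at h
  rw [h, mul_pow, Real.sq_sqrt (by positivity), rowSS]; ring

theorem rowSS_add_const {r : ℕ} (hr : r ≠ 0) (c : ℝ) (y : Fin r → ℝ) :
    rowSS (fun j => c + y j) = rowSS y := by
  have hr' : (r : ℝ) ≠ 0 := by exact_mod_cast hr
  unfold rowSS
  refine Finset.sum_congr rfl fun j _ => ?_
  rw [Finset.sum_add_distrib]
  simp only [Finset.sum_const, Finset.card_univ, Fintype.card_fin, nsmul_eq_mul]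
  field_simp; ring

/-- A common shift of a row does not change its sum of squares about the mean, so μ and the random
effect drop out. -/
theorem map_rowSS_rowLaw {r : ℕ} (hr : r ≠ 0) (μ : ℝ) (σa2 σ2 : ℝ≥0) :
    (rowLaw r μ σa2 σ2).map rowSS = (Measure.pi fun _ : Fin r => gaussianReal 0 σ2).map rowSS := by
  rw [rowLaw, Measure.map_map measurable_rowSS (measurable_row μ)]
  have : rowSS ∘ (fun (z : ℝ × (Fin r → ℝ)) (j : Fin r) => μ + z.1 + z.2 j) = rowSS ∘ Prod.snd := by
    ext z; exact rowSS_add_const hr (μ + z.1) z.2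
  rw [this, ← Measure.map_map measurable_rowSS measurable_snd,
    measurePreserving_snd.map_eq]

/-- The sum of squares about the mean is the raw sum of squares minus the square of a Gaussian
variable. The crude bound Var(A - B) ≤ 2 Var A + 2 Var B makes independence of mean and residuals
unnecessary. -/
theorem moments_rowSS_pi {r : ℕ} (hr : r ≠ 0) (v : ℝ≥0) :
    MemLp rowSS 2 (Measure.pi fun _ : Fin r => gaussianReal 0 v) ∧
    ∫ e, rowSS e ∂(Measure.pi fun _ : Fin r => gaussianReal 0 v) = (r - 1) * v ∧
    Var[rowSS; Measure.pi fun _ : Fin r => gaussianReal 0 v] ≤ 4 * sqVar * r * (v : ℝ) ^ 2 := by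
  have hr' : (r : ℝ) ≠ 0 := by exact_mod_cast hr
  set P := Measure.pi fun _ : Fin r => gaussianReal 0 v with hP
  have hlaw : ∀ j : Fin r, HasLaw (fun e : Fin r → ℝ => e j) (gaussianReal 0 v) P := 
    hasLaw_eval_pi _
  have hB : HasLaw (fun e : Fin r → ℝ => √(r : ℝ) * ((∑ k, e k) / r)) (gaussianReal 0 v) P := by
    have h := gaussianReal_const_mul (hasLaw_sum_pi_gaussianReal r v) (√(r : ℝ) * (r : ℝ)⁻¹)
    rw [mul_zero] at h
    convert h using 2
    · ring
    · refine NNReal.coe_injective ?_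
      push_cast
      rw [mul_pow, Real.sq_sqrt (by positivity)]
      field_simp
  have hA : MemLp (∑ j, fun e : Fin r → ℝ => e j ^ 2) 2 P :=
    memLp_finsetSum' _ fun j _ => memLp_sq_of_hasLaw (hlaw j)
  have hBm := memLp_sq_of_hasLaw hB
  have heq : (rowSS : (Fin r → ℝ) → ℝ) = (∑ j, fun e : Fin r → ℝ => e j ^ 2) -
      fun e : Fin r → ℝ => (√(r : ℝ) * ((∑ k, e k) / r)) ^ 2 := by
    ext e; rw [rowSS_eq hr]; simp
  rw [heq]
  refine ⟨hA.sub hBm, ?_, (variance_sub_le hA hBm).trans ?_⟩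
  · simp only [Pi.sub_apply]
    rw [integral_sub (hA.integrable one_le_two) (hBm.integrable one_le_two),
      integral_sq_of_hasLaw hB]
    simp only [Finset.sum_apply]
    rw [integral_finsetSum _ fun j _ => (memLp_sq_of_hasLaw (hlaw j)).integrable one_le_two]
    simp_rw [integral_sq_of_hasLaw (hlaw _)]
    simp; ring
  · rw [variance_sq_of_hasLaw hB, variance_sum_pi (X := fun _ x => x ^ 2)
      fun _ => memLp_sq_gaussianReal v]
    simp only [variance_sq_gaussianReal, Finset.sum_const, Finset.card_univ, Fintype.card_fin,
      nsmul_eq_mul]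
    have h1 : (1 : ℝ) ≤ r := by exact_mod_cast Nat.one_le_iff_ne_zero.2 hr
    have h2 : 0 ≤ sqVar * (v : ℝ) ^ 2 := mul_nonneg sqVar_nonneg (by positivity)
    nlinarith

theorem moments_rowSS {r : ℕ} (hr : r ≠ 0) (μ : ℝ) (σa2 σ2 : ℝ≥0) :
    MemLp rowSS 2 (rowLaw r μ σa2 σ2) ∧
    ∫ y, rowSS y ∂(rowLaw r μ σa2 σ2) = (r - 1) * σ2 ∧
    Var[rowSS; rowLaw r μ σa2 σ2] ≤ 4 * sqVar * r * (σ2 : ℝ) ^ 2 := by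
  obtain ⟨h1, h2, h3⟩ := moments_rowSS_pi hr σ2
  set P := Measure.pi fun _ : Fin r => gaussianReal 0 σ2
  have hlaw : HasLaw rowSS (P.map rowSS) (rowLaw r μ σa2 σ2) :=
    ⟨measurable_rowSS.aemeasurable, map_rowSS_rowLaw hr μ σa2 σ2⟩
  have hid : HasLaw rowSS (P.map rowSS) P := ⟨measurable_rowSS.aemeasurable, rfl⟩
  refine ⟨?_, ?_, ?_⟩
  · have : MemLp id 2 (P.map rowSS) :=
      (memLp_map_measure_iff (by fun_prop) measurable_rowSS.aemeasurable).2 h1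
    rw [← hlaw.map_eq] at this
    exact this.comp_of_map measurable_rowSS.aemeasurable
  · rw [hlaw.integral_eq, ← hid.integral_eq, h2]
  · rw [hlaw.variance_eq, ← hid.variance_eq]; exact h3

/-! ### Deviation bounds for the sums of squares -/

theorem pi_deviation_le {α : Type*} [MeasurableSpace α] (ν : Measure α) [IsProbabilityMeasure ν]
    (p : ℕ) {f : α → ℝ} (hf : MemLp f 2 ν) {t : ℝ} (ht : 0 < t) :
    (Measure.pi fun _ : Fin p => ν) {ω | t ≤ |∑ i, f (ω i) - p * ∫ x, f x ∂ν|}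
      ≤ ENNReal.ofReal (p * Var[f; ν] / t ^ 2) := by
  have hm : ∀ i : Fin p, MemLp (fun ω : Fin p → α => f (ω i)) 2 (Measure.pi fun _ : Fin p => ν) :=
    fun i => hf.comp_measurePreserving (measurePreserving_eval _ i)
  have h := meas_ge_le_variance_div_sq
    (memLp_finsetSum' (Finset.univ : Finset (Fin p)) fun i _ => hm i) ht
  rw [variance_sum_pi fun _ => hf] at h
  have hmean : ∫ ω, (∑ i, fun ω : Fin p → α => f (ω i)) ω ∂(Measure.pi fun _ : Fin p => ν)
      = p * ∫ x, f x ∂ν := by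
    simp only [Finset.sum_apply]
    rw [integral_finsetSum _ fun i _ => (hm i).integrable one_le_two]
    simp_rw [integral_comp_eval (μ := fun _ : Fin p => ν) hf.aestronglyMeasurable]
    simp
  rw [hmean] at h
  simpa using h

variable {p r : ℕ} {μ : ℝ} {σa2 σ2 : ℝ≥0}

theorem withinSS_deviation_le (hp : p ≠ 0) (hr : 2 ≤ r) (hσ : 0 < σ2) {δ : ℝ} (hδ : 0 < δ) :
    dataLaw p r μ σa2 σ2 {Y | δ * (p * (r - 1) * σ2) ≤ |withinSS Y - p * (r - 1) * σ2|}
      ≤ ENNReal.ofReal (16 * sqVar / δ ^ 2 / (p * r)) := by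
  obtain ⟨h1, h2, h3⟩ := moments_rowSS (show r ≠ 0 by lia) μ σa2 σ2
  have hp' : (0 : ℝ) < p := by exact_mod_cast Nat.pos_of_ne_zero hp
  have hr' : (2 : ℝ) ≤ r := by exact_mod_cast hr
  have hr1 : (0 : ℝ) < r - 1 := by linarith
  have hσ' : (0 : ℝ) < σ2 := by exact_mod_cast hσ
  have h := pi_deviation_le (rowLaw r μ σa2 σ2) p h1
    (show 0 < δ * (p * (r - 1) * σ2) by positivity)
  rw [h2, ← dataLaw_eq_pi, ← mul_assoc (p : ℝ)] at h
  refine h.trans (ENNReal.ofReal_le_ofReal ?_)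
  have hK := sqVar_nonneg
  calc p * Var[rowSS; rowLaw r μ σa2 σ2] / (δ * (p * (r - 1) * σ2)) ^ 2
      ≤ p * (4 * sqVar * r * (σ2 : ℝ) ^ 2) / (δ * (p * (r - 1) * σ2)) ^ 2 := by gcongr
    _ = 4 * sqVar / δ ^ 2 / p * (r / (r - 1) ^ 2) := by field_simp
    -- Uses r ≤ 2(r-1). The resulting bound depends on the dimensions only through pr, so it serves
    -- all three regimes.
    _ ≤ 4 * sqVar / δ ^ 2 / p * (4 / r) := by
        refine mul_le_mul_of_nonneg_left ?_ (by positivity)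
        rw [div_le_div_iff₀ (by positivity) (by positivity)]
        nlinarith
    _ = 16 * sqVar / δ ^ 2 / (p * r) := by field_simp; ring

theorem sum_unitMean_deviation_le (hr : r ≠ 0) {t : ℝ} (ht : 0 < t) :
    dataLaw p r μ σa2 σ2
        {Y | t ≤ |r * ∑ i, (unitMean Y i - μ) ^ 2 - p * ((σ2 : ℝ) + r * σa2)|}
      ≤ ENNReal.ofReal (p * (sqVar * ((σ2 : ℝ) + r * σa2) ^ 2) / t ^ 2) := by
  have hlaw := hasLaw_scaledRowMean hr μ σa2 σ2
  have h := pi_deviation_le (rowLaw r μ σa2 σ2) p (memLp_sq_of_hasLaw hlaw) ht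
  rw [integral_sq_of_hasLaw hlaw, variance_sq_of_hasLaw hlaw, ← dataLaw_eq_pi] at h
  push_cast at h
  simp_rw [mul_pow, Real.sq_sqrt (Nat.cast_nonneg r), ← Finset.mul_sum] at h
  exact h

theorem grandMean_deviation_le (hp : p ≠ 0) (hr : r ≠ 0) {t : ℝ} (ht : 0 < t) :
    dataLaw p r μ σa2 σ2 {Y | t ≤ p * r * (grandMean Y - μ) ^ 2}
      ≤ ENNReal.ofReal (((σ2 : ℝ) + r * σa2) / t) := by
  have hp' : (0 : ℝ) < p := by exact_mod_cast Nat.pos_of_ne_zero hp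
  have hlaw := hasLaw_scaledRowMean hr μ σa2 σ2
  have h := pi_deviation_le (rowLaw r μ σa2 σ2) p (memLp_of_hasLaw hlaw)
    (show 0 < √(p * t) by positivity)
  rw [hlaw.integral_eq, hlaw.variance_eq, ← dataLaw_eq_pi, integral_id_gaussianReal,
    variance_id_gaussianReal, Real.sq_sqrt (by positivity), mul_div_mul_left _ _ hp'.ne'] at h
  push_cast at h
  refine le_trans (measure_mono fun Y hY => ?_) h
  simp only [Set.mem_ofPred_eq, mul_zero, sub_zero] at hY ⊢
  have e : ∑ i, √(r : ℝ) * ((∑ j, Y i j) / r - μ) = √(r : ℝ) * (p * (grandMean Y - μ)) := by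
    rw [← Finset.mul_sum, Finset.sum_sub_distrib, grandMean_eq hr]
    simp only [unitMean, Finset.sum_const, Finset.card_univ, Fintype.card_fin, nsmul_eq_mul]
    field_simp
  rw [e]
  refine Real.sqrt_le_iff.2 ⟨abs_nonneg _, ?_⟩
  rw [sq_abs, mul_pow, Real.sq_sqrt (by positivity)]
  nlinarith

/-- H is the sum of squares of the unit means about the true μ, which is a sum over independent
units, minus pr(ȳ - μ)². Each of the two is allowed half of the tolerance. -/
theorem betweenSS_deviation_le (hp : p ≠ 0) (hr : r ≠ 0) (hσ : 0 < σ2) {δ : ℝ} (hδ : 0 < δ) :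
    dataLaw p r μ σa2 σ2 {Y | δ * (p * ((σ2 : ℝ) + r * σa2))
        ≤ |betweenSS Y - p * ((σ2 : ℝ) + r * σa2)|}
      ≤ ENNReal.ofReal ((4 * sqVar / δ ^ 2 + 2 / δ) / p) := by
  have hp' : (0 : ℝ) < p := by exact_mod_cast Nat.pos_of_ne_zero hp
  have hσ' : (0 : ℝ) < σ2 := by exact_mod_cast hσ
  set V := (σ2 : ℝ) + r * σa2 with hV
  have hV0 : 0 < V := by positivity
  have ht : 0 < δ / 2 * (p * V) := by positivity
  have h1 := sum_unitMean_deviation_le (p := p) (μ := μ) (σa2 := σa2) (σ2 := σ2) hr ht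
  have h2 := grandMean_deviation_le (μ := μ) (σa2 := σa2) (σ2 := σ2) hp hr ht
  rw [← hV] at h1 h2
  have hK := sqVar_nonneg
  have hsum : (4 * sqVar / δ ^ 2 + 2 / δ) / p
      = p * (sqVar * V ^ 2) / (δ / 2 * (p * V)) ^ 2 + V / (δ / 2 * (p * V)) := by
    field_simp; ring
  rw [hsum, ENNReal.ofReal_add (by positivity) (by positivity)]
  refine le_trans (measure_mono fun Y hY => ?_) ((measure_union_le _ _).trans (add_le_add h1 h2))
  by_contra hcon
  simp only [Set.mem_union, Set.mem_ofPred_eq, not_or, not_le] at hcon hY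
  have e := sum_unitMean_sub_sq hp hr Y μ
  have n : 0 ≤ (p : ℝ) * r * (grandMean Y - μ) ^ 2 := by positivity
  have a := abs_lt.1 hcon.1
  rw [e] at a
  have : |betweenSS Y - p * V| < δ * (p * V) := by
    rw [abs_lt]; constructor <;> linarith [a.1, a.2, hcon.2]
  linarith

/-- An upper bound for the sum of squares between groups under the null model. -/
theorem betweenSS_ge_le (hp : p ≠ 0) (hr : r ≠ 0) {t : ℝ} (ht : 0 < t) :
    dataLaw p r μ 0 σ2 {Y | p * (σ2 : ℝ) + t ≤ betweenSS Y}
      ≤ ENNReal.ofReal (p * (sqVar * (σ2 : ℝ) ^ 2) / t ^ 2) := by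
  have h := sum_unitMean_deviation_le (p := p) (μ := μ) (σa2 := 0) (σ2 := σ2) hr ht
  simp only [NNReal.coe_zero, mul_zero, add_zero] at h
  refine le_trans (measure_mono fun Y hY => ?_) h
  simp only [Set.mem_ofPred_eq] at hY ⊢
  have e := sum_unitMean_sub_sq hp hr Y μ
  have n : 0 ≤ (p : ℝ) * r * (grandMean Y - μ) ^ 2 := by positivity
  exact le_trans (by linarith) (le_abs_self _)

theorem gaussianReal_Icc_le {v : ℝ≥0} (hv : v ≠ 0) (δ : ℝ) :
    gaussianReal 0 v (Set.Icc (-δ) δ) ≤ ENNReal.ofReal (2 * δ / √(v : ℝ)) := by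
  have hv' : (0 : ℝ) < v := by exact_mod_cast pos_iff_ne_zero.2 hv
  rw [gaussianReal_apply 0 hv]
  calc ∫⁻ x in Set.Icc (-δ) δ, gaussianPDF 0 v x
      ≤ ∫⁻ x in Set.Icc (-δ) δ, ENNReal.ofReal (√(v : ℝ))⁻¹ := by
        refine lintegral_mono fun x => ENNReal.ofReal_le_ofReal ?_
        rw [gaussianPDFReal]
        calc (√(2 * Real.pi * v))⁻¹ * Real.exp (-(x - 0) ^ 2 / (2 * v))
            ≤ (√(v : ℝ))⁻¹ * 1 := by
              gcongr
              · have := Real.pi_gt_three; nlinarith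
              · rw [Real.exp_le_one_iff]
                exact div_nonpos_of_nonpos_of_nonneg (by nlinarith [sq_nonneg (x - 0)])
                  (by positivity)
          _ = _ := mul_one _
    _ = ENNReal.ofReal (2 * δ / √(v : ℝ)) := by
        rw [setLIntegral_const, Real.volume_Icc, ← ENNReal.ofReal_mul (by positivity)]
        congr 1; ring

/-- A lower bound for the sum of squares between groups when the number of units is fixed. -/
theorem betweenSS_le_le (hp : 2 ≤ p) (hr : r ≠ 0) (hσ : 0 < σa2) {κ : ℝ} (hκ : 0 < κ) :
    dataLaw p r μ σa2 σ2 {Y | betweenSS Y ≤ κ ^ 2 / 2 * r}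
      ≤ ENNReal.ofReal (2 * κ / √(σa2 : ℝ)) := by
  have hσ' : (0 : ℝ) < σa2 := by exact_mod_cast hσ
  have hr0 : (0 : ℝ) < r := by exact_mod_cast Nat.pos_of_ne_zero hr
  set w : ℝ≥0 := σa2 + σ2 / r with hw
  -- Two units suffice: H ≥ (r/2)(ȳᵢ - ȳₖ)², and the difference of the two unit means is Gaussian
  -- with variance at least σa² for every r.
  set i : Fin p := ⟨0, by lia⟩
  set k : Fin p := ⟨1, by lia⟩
  have hik : i ≠ k := by simp [i, k]
  set f : (Fin r → ℝ) → ℝ := fun y => (∑ j, y j) / r - μ with hf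
  have hlaw := hasLaw_rowMean hr μ σa2 σ2
  have hcoord : ∀ i : Fin p, HasLaw (fun Y : Fin p → Fin r → ℝ => f (Y i)) (gaussianReal 0 w)
      (dataLaw p r μ σa2 σ2) := fun i => by
    rw [dataLaw_eq_pi]
    exact hlaw.fun_comp (hasLaw_eval_pi _ i)
  have hind : IndepFun (fun Y : Fin p → Fin r → ℝ => f (Y i)) (fun Y => f (Y k))
      (dataLaw p r μ σa2 σ2) := by
    rw [dataLaw_eq_pi]
    exact (iIndepFun_pi (X := fun _ => f) fun _ => hlaw.aemeasurable).indepFun hik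
  have hneg := gaussianReal_neg (hcoord k)
  rw [neg_zero] at hneg
  have hdiff : Measure.map (fun Y => f (Y i) + -f (Y k)) (dataLaw p r μ σa2 σ2) = _ :=
    gaussianReal_add_gaussianReal_of_indepFun
    (hind.comp measurable_id measurable_neg) (hcoord i).map_eq hneg.map_eq
  rw [add_zero] at hdiff
  have hmeas : Measurable fun Y : Fin p → Fin r → ℝ => f (Y i) + -f (Y k) := by
    simp only [hf]; fun_prop
  have hww : w + w ≠ 0 := by
    have : 0 < w := lt_of_lt_of_le hσ (by rw [hw]; exact le_self_add)
    positivity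
  have hwle : (σa2 : ℝ) ≤ ((w + w : ℝ≥0) : ℝ) := by
    rw [hw]; push_cast
    have : (0 : ℝ) ≤ (σ2 : ℝ) / r := by positivity
    linarith
  calc dataLaw p r μ σa2 σ2 {Y | betweenSS Y ≤ κ ^ 2 / 2 * r}
      ≤ dataLaw p r μ σa2 σ2 ((fun Y => f (Y i) + -f (Y k)) ⁻¹' Set.Icc (-κ) κ) := by
        refine measure_mono fun Y hY => ?_
        simp only [Set.mem_ofPred_eq] at hY
        have h1 : (unitMean Y i - grandMean Y) ^ 2 + (unitMean Y k - grandMean Y) ^ 2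
            ≤ ∑ l, (unitMean Y l - grandMean Y) ^ 2 := by
          rw [← Finset.sum_pair (f := fun l => (unitMean Y l - grandMean Y) ^ 2) hik]
          exact Finset.sum_le_sum_of_subset_of_nonneg (Finset.subset_univ _)
            fun _ _ _ => sq_nonneg _
        have h2 : ∑ l, (unitMean Y l - grandMean Y) ^ 2 ≤ κ ^ 2 / 2 := by
          unfold betweenSS at hY
          nlinarith
        have h3 : f (Y i) + -f (Y k) = unitMean Y i - unitMean Y k := by
          simp only [hf, unitMean]; ring
        simp only [Set.mem_preimage, h3]
        exact Set.mem_Icc.2 (abs_le.1 (abs_le_of_sq_le_sq (by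
          nlinarith [sq_nonneg (unitMean Y i - grandMean Y + (unitMean Y k - grandMean Y))])
          hκ.le))
    _ = gaussianReal 0 (w + w) (Set.Icc (-κ) κ) := by
        rw [← hdiff, Measure.map_apply hmeas measurableSet_Icc]
    _ ≤ ENNReal.ofReal (2 * κ / √((w + w : ℝ≥0) : ℝ)) := gaussianReal_Icc_le hww κ
    _ ≤ ENNReal.ofReal (2 * κ / √(σa2 : ℝ)) := by
        refine ENNReal.ofReal_le_ofReal ?_
        gcongr

end

/-! ### Bounds for the closed form -/

section Bounds

variable {p r : ℕ} {α : ℝ} {Y : Fin p → Fin r → ℝ}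

theorem closedBF_eq (hr : r ≠ 0) (hE : 0 < withinSS Y) :
    closedBF α Y = gammaFactor p r α *
      (1 + betweenSS Y / withinSS Y) ^ ((p : ℝ) * (r - 1) / 2 - (1 + α)) := by
  have hH := betweenSS_nonneg Y
  have h : withinSS Y / totalSS Y = (1 + betweenSS Y / withinSS Y)⁻¹ := by
    rw [totalSS_eq hr]; field_simp
  rw [closedBF, h, Real.inv_rpow (by positivity), ← Real.rpow_neg (by positivity), gammaFactor]
  congr 2; ring

theorem closedBF_pos (hp : 2 ≤ p) (hr : 2 ≤ r) (hα : -1 < α) (hE : 0 < withinSS Y) :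
    0 < closedBF α Y := by
  have hH := betweenSS_nonneg Y
  rw [closedBF_eq (by lia) hE]
  exact mul_pos (gammaFactor_pos hp hr hα) (Real.rpow_pos_of_pos (by positivity) _)

theorem log_closedBF (hp : 2 ≤ p) (hr : 2 ≤ r) (hα : -1 < α) (hE : 0 < withinSS Y) :
    Real.log (closedBF α Y) = Real.log (gammaFactor p r α) +
      ((p : ℝ) * (r - 1) / 2 - (1 + α)) * Real.log (1 + betweenSS Y / withinSS Y) := by
  have hH := betweenSS_nonneg Y
  have h0 : 0 < 1 + betweenSS Y / withinSS Y := by positivity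
  rw [closedBF_eq (by lia) hE, Real.log_mul (gammaFactor_pos hp hr hα).ne'
    (Real.rpow_pos_of_pos h0 _).ne', Real.log_rpow h0]

/-- The contribution -(1+α) log(1 + H/E) is nonpositive and can be discarded, so the upper bound
needs no condition on the sign of the exponent. -/
theorem closedBF_le (hp : 2 ≤ p) (hr : 2 ≤ r) (hα : -1 < α) (hE : 0 < withinSS Y) {C x : ℝ}
    (hC : |Real.log (gammaFactor p r α) + (p : ℝ) / 2 * gammaRate r| ≤ C * Real.log ((p : ℝ) * r))
    (hx : betweenSS Y / withinSS Y ≤ x) :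
    closedBF α Y ≤ Real.exp ((p : ℝ) / 2 * ((r - 1) * Real.log (1 + x) - gammaRate r)
      + C * Real.log ((p : ℝ) * r)) := by
  have hH := betweenSS_nonneg Y
  have hX : 0 ≤ betweenSS Y / withinSS Y := by positivity
  have hr' : (2 : ℝ) ≤ r := by exact_mod_cast hr
  rw [← Real.log_le_iff_le_exp (closedBF_pos hp hr hα hE), log_closedBF hp hr hα hE]
  have h1 : Real.log (1 + betweenSS Y / withinSS Y) ≤ Real.log (1 + x) :=
    Real.log_le_log (by positivity) (by linarith)
  have h2 : 0 ≤ Real.log (1 + betweenSS Y / withinSS Y) := Real.log_nonneg (by linarith)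
  have h3 : (p : ℝ) * (r - 1) / 2 * Real.log (1 + betweenSS Y / withinSS Y)
      ≤ (p : ℝ) * (r - 1) / 2 * Real.log (1 + x) :=
    mul_le_mul_of_nonneg_left h1 (by have : (0 : ℝ) ≤ p := p.cast_nonneg; nlinarith)
  have h4 : 0 ≤ (1 + α) * Real.log (1 + betweenSS Y / withinSS Y) :=
    mul_nonneg (by linarith) h2
  linarith [(abs_le.1 hC).2]

/-- Here the exponent must be nonnegative, so that the closed form is monotone in H/E. -/
theorem le_closedBF (hp : 2 ≤ p) (hr : 2 ≤ r) (hα : -1 < α) (hE : 0 < withinSS Y) {C x : ℝ}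
    (hC : |Real.log (gammaFactor p r α) + (p : ℝ) / 2 * gammaRate r| ≤ C * Real.log ((p : ℝ) * r))
    (hγ : 1 + α ≤ (p : ℝ) * (r - 1) / 2) (hx0 : 0 ≤ x) (hx : x ≤ betweenSS Y / withinSS Y) :
    Real.exp ((p : ℝ) / 2 * ((r - 1) * Real.log (1 + x) - gammaRate r)
      - (1 + α) * Real.log (1 + x) - C * Real.log ((p : ℝ) * r)) ≤ closedBF α Y := by
  rw [← Real.le_log_iff_exp_le (closedBF_pos hp hr hα hE), log_closedBF hp hr hα hE]
  have h1 : Real.log (1 + x) ≤ Real.log (1 + betweenSS Y / withinSS Y) :=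
    Real.log_le_log (by positivity) (by linarith)
  have h3 := mul_le_mul_of_nonneg_left h1 (sub_nonneg.2 hγ)
  linarith [(abs_le.1 hC).1]

end Bounds

/-! ### Criteria for convergence in probability -/

section Criteria

variable {ι : Type*} {l : Filter ι} {Ω : ι → Type*} [∀ k, MeasurableSpace (Ω k)]
  {P : ∀ k, Measure (Ω k)} {X : ∀ k, Ω k → ℝ}

theorem tendsto_measure_zero {S : ∀ k, Set (Ω k)}
    (h : ∀ ε : ℝ, 0 < ε → ∀ᶠ k in l, P k (S k) ≤ ENNReal.ofReal ε) :
    Tendsto (fun k => P k (S k)) l (𝓝 0) := by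
  rw [ENNReal.tendsto_nhds_zero]
  intro ε hε
  rcases eq_or_ne ε ⊤ with rfl | htop
  · simp
  · have := h ε.toReal (ENNReal.toReal_pos hε.ne' htop)
    rwa [ENNReal.ofReal_toReal htop] at this

/-- The bound u and the exceptional events may depend on ε. This matters for fixed p, where H is
only bounded in probability. -/
theorem plimZero_of_le (h : ∀ ε : ℝ, 0 < ε → ∃ (u : ι → ℝ) (B : ∀ k, Set (Ω k)),
    Tendsto u l (𝓝 0) ∧ (∀ᶠ k in l, P k (B k) ≤ ENNReal.ofReal ε) ∧
      ∀ᶠ k in l, ∀ ω ∉ B k, |X k ω| ≤ u k) :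
    PlimZero l P X := by
  intro δ hδ
  refine tendsto_measure_zero fun ε hε => ?_
  obtain ⟨u, B, hu, hB, hX⟩ := h ε hε
  filter_upwards [hB, hX, hu.eventually (gt_mem_nhds hδ)] with k h1 h2 h3
  refine (measure_mono fun ω hω => ?_).trans h1
  by_contra hcon
  have hω' : δ ≤ |X k ω| := hω
  linarith [h2 ω hcon]

theorem plimTop_of_le (h : ∀ ε : ℝ, 0 < ε → ∃ (u : ι → ℝ) (B : ∀ k, Set (Ω k)),
    Tendsto u l atTop ∧ (∀ᶠ k in l, P k (B k) ≤ ENNReal.ofReal ε) ∧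
      ∀ᶠ k in l, ∀ ω ∉ B k, u k ≤ X k ω) :
    PlimTop l P X := by
  intro C
  refine tendsto_measure_zero fun ε hε => ?_
  obtain ⟨u, B, hu, hB, hX⟩ := h ε hε
  filter_upwards [hB, hX, hu.eventually_gt_atTop C] with k h1 h2 h3
  refine (measure_mono fun ω hω => ?_).trans h1
  by_contra hcon
  have hω' : X k ω ≤ C := hω
  linarith [h2 ω hcon]

/-- Otherwise the exceptional event and {X ≤ C}, which together cover the space, would both have
vanishing probability. -/
theorem not_plimTop_of_le [l.NeBot] [∀ k, IsProbabilityMeasure (P k)] {B : ∀ k, Set (Ω k)} {C : ℝ}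
    (hB : ∀ ε : ℝ, 0 < ε → ∀ᶠ k in l, P k (B k) ≤ ENNReal.ofReal ε)
    (hX : ∀ᶠ k in l, ∀ ω ∉ B k, X k ω ≤ C) : ¬ PlimTop l P X := by
  intro h
  have h1 := (tendsto_measure_zero hB).add (h C)
  rw [add_zero] at h1
  obtain ⟨k, hk, hk2⟩ := ((h1.eventually (gt_mem_nhds one_pos)).and hX).exists
  have h2 : (Set.univ : Set (Ω k)) ⊆ B k ∪ {ω | X k ω ≤ C} := fun ω _ => by
    by_cases hω : ω ∈ B k
    · exact Or.inl hω
    · exact Or.inr (hk2 ω hω)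
  have h3 := (measure_mono h2).trans (measure_union_le (μ := P k) _ _)
  rw [measure_univ] at h3
  exact absurd hk (not_lt.2 h3)

end Criteria

theorem tendsto_mul_sub_log (c C : ℝ) (hc : 0 < c) :
    Tendsto (fun x : ℝ => c * x - C * Real.log x) atTop atTop := by
  have h := (Real.isLittleO_log_id_atTop.const_mul_left C).bound (show 0 < c / 2 by positivity)
  refine tendsto_atTop_mono' _ ?_ (tendsto_id.const_mul_atTop (show 0 < c / 2 by positivity))
  filter_upwards [h, eventually_ge_atTop 0] with x hx hx0
  have h2 := (le_abs_self _).trans hx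
  simp only [id, Real.norm_eq_abs, abs_of_nonneg hx0] at h2 ⊢
  linarith

/-! ### The exceptional events -/

/-- The event that the sum of squares within groups deviates from its mean by a factor `δ`. -/
def withinBad (p r : ℕ) (σ2 : ℝ≥0) (δ : ℝ) : Set (Fin p → Fin r → ℝ) :=
  {Y | δ * (p * (r - 1) * σ2) ≤ |withinSS Y - p * (r - 1) * σ2|}

/-- The event that the sum of squares between groups deviates from `p (σ² + r σa²)` by a
factor `δ`. -/
def betweenBad (p r : ℕ) (σa2 σ2 : ℝ≥0) (δ : ℝ) : Set (Fin p → Fin r → ℝ) :=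
  {Y | δ * (p * ((σ2 : ℝ) + r * σa2)) ≤ |betweenSS Y - p * ((σ2 : ℝ) + r * σa2)|}

theorem within_bounds {p r : ℕ} {σ2 : ℝ≥0} {δ : ℝ} {Y : Fin p → Fin r → ℝ}
    (h : Y ∉ withinBad p r σ2 δ) :
    (1 - δ) * (p * (r - 1) * σ2) < withinSS Y ∧ withinSS Y < (1 + δ) * (p * (r - 1) * σ2) := by
  simp only [withinBad, Set.mem_ofPred_eq, not_le] at h
  have := abs_lt.1 h
  constructor <;> linarith [this.1, this.2]

theorem between_bounds {p r : ℕ} {σa2 σ2 : ℝ≥0} {δ : ℝ} {Y : Fin p → Fin r → ℝ}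
    (h : Y ∉ betweenBad p r σa2 σ2 δ) :
    (1 - δ) * (p * ((σ2 : ℝ) + r * σa2)) < betweenSS Y ∧
      betweenSS Y < (1 + δ) * (p * ((σ2 : ℝ) + r * σa2)) := by
  simp only [betweenBad, Set.mem_ofPred_eq, not_le] at h
  have := abs_lt.1 h
  constructor <;> linarith [this.1, this.2]

theorem ratio_bounds {p r : ℕ} {σa2 σ2 : ℝ≥0} {δ : ℝ} {Y : Fin p → Fin r → ℝ} (hp : p ≠ 0)
    (hr : 2 ≤ r) (hσ : 0 < σ2) (hδ0 : 0 < δ) (hδ : δ < 1)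
    (h : Y ∉ withinBad p r σ2 δ ∪ betweenBad p r σa2 σ2 δ) :
    0 < withinSS Y ∧
    (1 - δ) / (1 + δ) * (((σ2 : ℝ) + r * σa2) / ((r - 1) * σ2)) ≤ betweenSS Y / withinSS Y ∧
    betweenSS Y / withinSS Y ≤ (1 + δ) / (1 - δ) * (((σ2 : ℝ) + r * σa2) / ((r - 1) * σ2)) := by
  rw [Set.mem_union, not_or] at h
  obtain ⟨a1, a2⟩ := within_bounds h.1
  obtain ⟨b1, b2⟩ := between_bounds h.2
  have hp' : (0 : ℝ) < p := by exact_mod_cast Nat.pos_of_ne_zero hp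
  have hr' : (2 : ℝ) ≤ r := by exact_mod_cast hr
  have hr1 : (0 : ℝ) < r - 1 := by linarith
  have hσ' : (0 : ℝ) < σ2 := by exact_mod_cast hσ
  have hδ1 : 0 < 1 - δ := by linarith
  set V := (σ2 : ℝ) + r * σa2 with hV
  have hV0 : 0 < V := by positivity
  have hE : 0 < withinSS Y := lt_trans (by positivity) a1
  refine ⟨hE, ?_, ?_⟩
  · calc (1 - δ) / (1 + δ) * (V / ((r - 1) * σ2))
        = (1 - δ) * (p * V) / ((1 + δ) * (p * (r - 1) * σ2)) := by field_simp
      _ ≤ betweenSS Y / withinSS Y := by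
          have := betweenSS_nonneg Y
          gcongr
  · calc betweenSS Y / withinSS Y
        ≤ (1 + δ) * (p * V) / ((1 - δ) * (p * (r - 1) * σ2)) := by gcongr
      _ = (1 + δ) / (1 - δ) * (V / ((r - 1) * σ2)) := by field_simp

section Events

variable {ι : Type*} {l : Filter ι} {p r : ι → ℕ} {μ : ℝ} {σa2 σ2 : ℝ≥0} {δ ε : ℝ}

theorem eventually_ofReal_div_le {u : ι → ℝ} (hu : Tendsto u l atTop) (A : ℝ) (hε : 0 < ε) :
    ∀ᶠ k in l, ENNReal.ofReal (A / u k) ≤ ENNReal.ofReal ε := by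
  filter_upwards [(hu.const_div_atTop A).eventually (gt_mem_nhds hε)] with k hk
  exact ENNReal.ofReal_le_ofReal hk.le

theorem eventually_withinBad_le (hpr : Tendsto (fun k => (p k : ℝ) * r k) l atTop)
    (hp : ∀ᶠ k in l, p k ≠ 0) (hr : ∀ᶠ k in l, 2 ≤ r k) (hσ : 0 < σ2) (hδ : 0 < δ) (hε : 0 < ε) :
    ∀ᶠ k in l, dataLaw (p k) (r k) μ σa2 σ2 (withinBad (p k) (r k) σ2 δ) ≤ ENNReal.ofReal ε := by
  filter_upwards [eventually_ofReal_div_le hpr (16 * sqVar / δ ^ 2) hε, hp, hr] with k h1 h2 h3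
  exact (withinSS_deviation_le h2 h3 hσ hδ).trans h1

theorem eventually_bad_le (hp : Tendsto p l atTop) (hr : ∀ᶠ k in l, 2 ≤ r k) (hσ : 0 < σ2)
    (hδ : 0 < δ) (hε : 0 < ε) :
    ∀ᶠ k in l, dataLaw (p k) (r k) μ σa2 σ2
      (withinBad (p k) (r k) σ2 δ ∪ betweenBad (p k) (r k) σa2 σ2 δ) ≤ ENNReal.ofReal ε := by
  have hp' : Tendsto (fun k => (p k : ℝ)) l atTop := tendsto_natCast_atTop_atTop.comp hp
  have hp0 : ∀ᶠ k in l, p k ≠ 0 := hp.eventually_ne_atTop 0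
  have hpr : Tendsto (fun k => (p k : ℝ) * r k) l atTop := by
    refine tendsto_atTop_mono' _ ?_ hp'
    filter_upwards [hr] with k hk
    have : (2 : ℝ) ≤ r k := by exact_mod_cast hk
    have : (0 : ℝ) ≤ p k := Nat.cast_nonneg _
    nlinarith
  filter_upwards [eventually_withinBad_le (μ := μ) (σa2 := σa2) hpr hp0 hr hσ hδ (half_pos hε),
    eventually_ofReal_div_le hp' (4 * sqVar / δ ^ 2 + 2 / δ) (half_pos hε), hp0, hr]
    with k h1 h2 h3 h4
  refine (measure_union_le _ _).trans ((add_le_add h1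
    ((betweenSS_deviation_le h3 (by lia) hσ hδ).trans h2)).trans_eq ?_)
  rw [← ENNReal.ofReal_add (by positivity) (by positivity), add_halves]

/-! ### Consistency under the null model -/

/-- Under the null model the Bayes factor tends to `0` as the number of units grows. -/
theorem plimZero_of_tendsto_units {α : ℝ} (hα : -1 < α) (hp : Tendsto p l atTop)
    (hr : ∀ᶠ k in l, 2 ≤ r k) (hσ : 0 < σ2) :
    PlimZero l (fun k => dataLaw (p k) (r k) μ 0 σ2) fun _ Y => closedBF α Y := by
  obtain ⟨C, hC0, hC⟩ := exists_abs_log_gammaFactor_add_le hα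
  have hp' : Tendsto (fun k => (p k : ℝ)) l atTop := tendsto_natCast_atTop_atTop.comp hp
  refine plimZero_of_le fun ε hε => ⟨fun k => Real.exp (-(1 / 8 * p k - C * Real.log (p k))),
    fun k => withinBad (p k) (r k) σ2 (1 / 20) ∪ betweenBad (p k) (r k) 0 σ2 (1 / 20),
    Real.tendsto_exp_atBot.comp (tendsto_neg_atTop_atBot.comp
      ((tendsto_mul_sub_log (1 / 8) C (by norm_num)).comp hp')),
    eventually_bad_le hp hr hσ (by norm_num) hε, ?_⟩
  filter_upwards [hp.eventually_ge_atTop 2, hp'.eventually_ge_atTop (8 * C), hr]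
    with k hp2 hpC hr2 Y hY
  obtain ⟨hE, -, hx⟩ := ratio_bounds (by lia) hr2 hσ (by norm_num) (by norm_num) hY
  have hr' : (2 : ℝ) ≤ r k := by exact_mod_cast hr2
  have hp'' : (2 : ℝ) ≤ p k := by exact_mod_cast hp2
  have hσ' : (0 : ℝ) < σ2 := by exact_mod_cast hσ
  have hr1 : (0 : ℝ) < r k - 1 := by linarith
  -- Under the null model H/E is close to 1/(r-1). The tolerance 1/20 gives the factor 21/19 ≤ 9/8.
  have hx' : betweenSS Y / withinSS Y ≤ 9 / 8 / (r k - 1) := by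
    refine hx.trans ?_
    rw [NNReal.coe_zero, mul_zero, add_zero, mul_comm ((r k : ℝ) - 1), ← div_div,
      div_self hσ'.ne', div_eq_mul_one_div (9 / 8 : ℝ)]
    exact mul_le_mul_of_nonneg_right (by norm_num) (by positivity)
  rw [abs_of_pos (closedBF_pos hp2 hr2 hα hE)]
  refine (closedBF_le hp2 hr2 hα hE (hC _ _ hp2 hr2) hx').trans (Real.exp_le_exp.2 ?_)
  -- After multiplication by r - 1, the excess of 9/8 over 1 costs at most 1/8 uniformly in r, less
  -- than the gain log r ≥ 1/2.
  have hlog : Real.log (1 + 9 / 8 / (r k - 1))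
      ≤ Real.log (r k) - Real.log (r k - 1) + 1 / 8 / r k := by
    have e : 1 + 9 / 8 / ((r k : ℝ) - 1) = r k / (r k - 1) * (1 + 1 / 8 / r k) := by
      field_simp; ring
    rw [e, Real.log_mul (by positivity) (by positivity), Real.log_div (by positivity) hr1.ne']
    have := Real.log_le_sub_one_of_pos (show 0 < 1 + 1 / 8 / (r k : ℝ) by positivity)
    linarith
  have hmul : ((r k : ℝ) - 1) * Real.log (1 + 9 / 8 / (r k - 1))
      ≤ (r k - 1) * (Real.log (r k) - Real.log (r k - 1)) + 1 / 8 := by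
    have h1 := mul_le_mul_of_nonneg_left hlog hr1.le
    have h2 : ((r k : ℝ) - 1) * (1 / 8 / r k) ≤ 1 / 8 := by
      rw [mul_div_assoc', div_le_iff₀ (by positivity)]; linarith
    linarith
  have hlogr : 1 / 2 ≤ Real.log (r k) := by
    have := Real.log_le_log (by norm_num) hr'
    linarith [Real.log_two_gt_d9]
  have hmain : (p k : ℝ) / 2 * ((r k - 1) * Real.log (1 + 9 / 8 / (r k - 1)) - gammaRate (r k))
      ≤ (p k : ℝ) / 2 * (1 / 8 - Real.log (r k)) := by
    refine mul_le_mul_of_nonneg_left ?_ (by positivity)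
    unfold gammaRate; linarith
  rw [Real.log_mul (by positivity) (by positivity)]
  -- As p ≥ 8C, what remains apart from C log p is at most p/16 - (3p/8) log r ≤ -p/8, the rate
  -- announced in u.
  have h5 : C * Real.log (r k) ≤ p k / 8 * Real.log (r k) := by
    refine mul_le_mul_of_nonneg_right ?_ (by linarith)
    linarith
  nlinarith

/-- Under the null model the Bayes factor tends to `0` as the number of observations per unit
grows while the number of units is fixed. -/
theorem plimZero_of_fixed_units {α : ℝ} (hα : -1 < α) {p : ℕ} (hp : 2 ≤ p) (hσ : 0 < σ2) :
    PlimZero atTop (fun r : ℕ => dataLaw p r μ 0 σ2) fun _ Y => closedBF α Y := by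
  have hp' : (2 : ℝ) ≤ p := by exact_mod_cast hp
  have hσ' : (0 : ℝ) < σ2 := by exact_mod_cast hσ
  have hcast : Tendsto (fun r : ℕ => (r : ℝ)) atTop atTop := tendsto_natCast_atTop_atTop
  have hK := sqVar_nonneg
  have hG : Tendsto (fun r : ℕ => gammaFactor p r α) atTop (𝓝 0) := by
    have h1 := tendsto_Gamma_div_Gamma_add (show (0 : ℝ) < ((p : ℝ) - 1) / 2 by linarith)
    have h2 : Tendsto (fun r : ℕ => ((p : ℝ) * r - p) / 2) atTop atTop := by
      have : Tendsto (fun r : ℕ => (p : ℝ) / 2 * r + -(p / 2)) atTop atTop :=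
        tendsto_atTop_add_const_right _ _ (hcast.const_mul_atTop (by positivity))
      refine this.congr fun r => by ring
    have h3 := (h1.comp h2).const_mul
      (Real.Gamma ((p : ℝ) / 2 + α + 1 / 2) / Real.Gamma (α + 1))
    rw [mul_zero] at h3
    refine h3.congr fun r => ?_
    simp only [Function.comp]
    rw [gammaFactor, show ((p : ℝ) * r - p) / 2 + (p - 1) / 2 = (p * r - 1) / 2 by ring,
      div_mul_div_comm, mul_comm (Real.Gamma (α + 1))]
  refine plimZero_of_le fun ε hε => ?_
  obtain ⟨t, ht0, ht⟩ : ∃ t : ℝ, 0 < t ∧ p * (sqVar * (σ2 : ℝ) ^ 2) / t ^ 2 ≤ ε / 2 := by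
    have h := Tendsto.const_div_atTop (tendsto_pow_atTop (α := ℝ) two_ne_zero)
      (p * (sqVar * (σ2 : ℝ) ^ 2))
    obtain ⟨t, h1, h2⟩ := ((eventually_gt_atTop 0).and
      (h.eventually (gt_mem_nhds (half_pos hε)))).exists
    exact ⟨t, h1, h2.le⟩
  -- Off the exceptional event H < pσ² + t and E > p(r-1)σ²/2, so H/E ≤ M/(p(r-1)) and the power of
  -- 1 + H/E is at most exp(M/2), independently of r.
  set M := 2 * (p * σ2 + t) / (σ2 : ℝ) with hM
  refine ⟨fun r => gammaFactor p r α * Real.exp (M / 2),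
    fun r => withinBad p r σ2 (1 / 2) ∪ {Y | p * (σ2 : ℝ) + t ≤ betweenSS Y}, ?_, ?_, ?_⟩
  · simpa using hG.mul_const (Real.exp (M / 2))
  · filter_upwards [eventually_withinBad_le (μ := μ) (σa2 := 0) (p := fun _ => p)
      (r := fun r => r) (hcast.const_mul_atTop (show (0 : ℝ) < p by positivity))
      (Eventually.of_forall fun _ => by lia) (eventually_ge_atTop 2) hσ
      (show (0 : ℝ) < 1 / 2 by norm_num) (half_pos hε), eventually_ge_atTop 1] with r h1 h2
    refine (measure_union_le _ _).trans ((add_le_add h1 ((betweenSS_ge_le (by lia) (by lia)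
      ht0).trans (ENNReal.ofReal_le_ofReal ht))).trans_eq ?_)
    rw [← ENNReal.ofReal_add (by positivity) (by positivity), add_halves]
  · filter_upwards [eventually_ge_atTop 2] with r hr Y hY
    rw [Set.mem_union, not_or] at hY
    have hr' : (2 : ℝ) ≤ r := by exact_mod_cast hr
    have hr1 : (0 : ℝ) < r - 1 := by linarith
    obtain ⟨a, -⟩ := within_bounds hY.1
    have b : betweenSS Y < p * σ2 + t := not_le.1 hY.2
    have hE : 0 < withinSS Y := lt_trans (by positivity) a
    have hH := betweenSS_nonneg Y
    have hG0 := gammaFactor_pos hp hr hα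
    rw [abs_of_pos (closedBF_pos hp hr hα hE), closedBF_eq (by lia) hE]
    refine mul_le_mul_of_nonneg_left ?_ hG0.le
    have hX0 : 0 ≤ betweenSS Y / withinSS Y := by positivity
    have hX : betweenSS Y / withinSS Y ≤ M / (p * (r - 1)) := by
      calc betweenSS Y / withinSS Y ≤ (p * σ2 + t) / ((1 - 1 / 2) * (p * (r - 1) * σ2)) := by
            gcongr
        _ = M / (p * (r - 1)) := by rw [hM]; field_simp; ring
    calc (1 + betweenSS Y / withinSS Y) ^ ((p : ℝ) * (r - 1) / 2 - (1 + α))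
        ≤ (1 + betweenSS Y / withinSS Y) ^ ((p : ℝ) * (r - 1) / 2) :=
          Real.rpow_le_rpow_of_exponent_le (by linarith) (by linarith)
      _ ≤ Real.exp (betweenSS Y / withinSS Y) ^ ((p : ℝ) * (r - 1) / 2) :=
          Real.rpow_le_rpow (by linarith)
            (by linarith [Real.add_one_le_exp (betweenSS Y / withinSS Y)]) (by positivity)
      _ = Real.exp (betweenSS Y / withinSS Y * (p * (r - 1) / 2)) := (Real.exp_mul _ _).symm
      _ ≤ Real.exp (M / (p * (r - 1)) * (p * (r - 1) / 2)) := by gcongr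
      _ = Real.exp (M / 2) := by congr 1; field_simp

/-! ### Consistency under the alternative -/

/-- The Bayes factor tends to `∞` as the number of observations per unit grows, provided that the
ratio of the sums of squares stays away from `0`. -/
theorem plimTop_of_tendsto_obs {α : ℝ} (hα : -1 < α) (hp : ∀ᶠ k in l, 2 ≤ p k)
    (hr : Tendsto r l atTop)
    (h : ∀ ε : ℝ, 0 < ε → ∃ (x : ℝ) (B : ∀ k, Set (Fin (p k) → Fin (r k) → ℝ)), 0 < x ∧
      (∀ᶠ k in l, dataLaw (p k) (r k) μ σa2 σ2 (B k) ≤ ENNReal.ofReal ε) ∧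
      ∀ᶠ k in l, ∀ Y ∉ B k, 0 < withinSS Y ∧ x ≤ betweenSS Y / withinSS Y) :
    PlimTop l (fun k => dataLaw (p k) (r k) μ σa2 σ2) fun _ Y => closedBF α Y := by
  obtain ⟨C, hC0, hC⟩ := exists_abs_log_gammaFactor_add_le hα
  have hr' : Tendsto (fun k => (r k : ℝ)) l atTop := tendsto_natCast_atTop_atTop.comp hr
  refine plimTop_of_le fun ε hε => ?_
  obtain ⟨x, B, hx, hB, hY⟩ := h ε hε
  set L := Real.log (1 + x) with hL
  have hL0 : 0 < L := Real.log_pos (by linarith)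
  -- With log p ≤ p and 1 ≤ p, every term of the lower bound for log BF is absorbed into p · w(r).
  -- Hence only r → ∞ matters, whatever p does.
  set w : ℝ → ℝ := fun s => L / 2 * s - (1 / 2 + C) * Real.log s
    + -(L / 2 + (1 + α) * L + 1 / 2 + C) with hw
  have hwt : Tendsto (fun k => w (r k)) l atTop :=
    (tendsto_atTop_add_const_right _ _ (tendsto_mul_sub_log _ _ (half_pos hL0))).comp hr'
  refine ⟨fun k => Real.exp (w (r k)), B, Real.tendsto_exp_atTop.comp hwt, hB, ?_⟩
  filter_upwards [hY, hp, hr.eventually_ge_atTop 2, hr'.eventually_ge_atTop (2 + α),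
    hwt.eventually_ge_atTop 0] with k hk hp2 hr2 hrα hw0 Y hYB
  obtain ⟨hE, hxX⟩ := hk Y hYB
  have hp' : (2 : ℝ) ≤ p k := by exact_mod_cast hp2
  have hr'' : (2 : ℝ) ≤ r k := by exact_mod_cast hr2
  have hγ : 1 + α ≤ (p k : ℝ) * (r k - 1) / 2 := by nlinarith
  refine le_trans (Real.exp_le_exp.2 ?_)
    (le_closedBF hp2 hr2 hα hE (hC _ _ hp2 hr2) hγ hx.le hxX)
  rw [← hL, Real.log_mul (by positivity) (by positivity)]
  have h1 : Real.log (p k) ≤ p k := (Real.log_le_sub_one_of_pos (by positivity)).trans (by linarith)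
  have h2 := gammaRate_le hr2
  have h3 : 0 ≤ Real.log (r k) := Real.log_nonneg (by linarith)
  have h4 : w (r k) ≤ p k * w (r k) := le_mul_of_one_le_left hw0 (by linarith)
  refine h4.trans ?_
  have h5 : (p k : ℝ) / 2 * gammaRate (r k) ≤ p k / 2 * (Real.log (r k) + 1) := by gcongr
  have h6 : C * Real.log (p k) ≤ C * p k := by gcongr
  have h7 : C * Real.log (r k) ≤ p k * (C * Real.log (r k)) :=
    le_mul_of_one_le_left (by positivity) (by linarith)
  have h8 : (1 + α) * L ≤ p k * ((1 + α) * L) :=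
    le_mul_of_one_le_left (mul_nonneg (by linarith) hL0.le) (by linarith)
  simp only [hw]
  linarith

/-- With p fixed H need not concentrate, but with high probability it is at least a constant times
r, while E is of order r. -/
theorem plimTop_of_fixed_units {α : ℝ} (hα : -1 < α) {p : ℕ} (hp : 2 ≤ p) (hσ : 0 < σ2)
    (hσa : 0 < σa2) :
    PlimTop atTop (fun r : ℕ => dataLaw p r μ σa2 σ2) fun _ Y => closedBF α Y := by
  have hp' : (2 : ℝ) ≤ p := by exact_mod_cast hp
  have hσ' : (0 : ℝ) < σ2 := by exact_mod_cast hσ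
  have hσa' : (0 : ℝ) < σa2 := by exact_mod_cast hσa
  have hcast : Tendsto (fun r : ℕ => (r : ℝ)) atTop atTop := tendsto_natCast_atTop_atTop
  refine plimTop_of_tendsto_obs (p := fun _ => p) (r := fun r => r) hα
    (Eventually.of_forall fun _ => hp) tendsto_id fun ε hε => ?_
  -- Makes the small-ball probability 2κ/√σa² equal to ε/2.
  set κ := ε / 4 * √(σa2 : ℝ) with hκ
  have hκ0 : 0 < κ := by positivity
  refine ⟨κ ^ 2 / (3 * p * σ2),
    fun r => withinBad p r σ2 (1 / 2) ∪ {Y | betweenSS Y ≤ κ ^ 2 / 2 * r}, by positivity, ?_, ?_⟩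
  · filter_upwards [eventually_withinBad_le (μ := μ) (σa2 := σa2) (p := fun _ => p)
      (r := fun r => r) (hcast.const_mul_atTop (show (0 : ℝ) < p by positivity))
      (Eventually.of_forall fun _ => by lia) (eventually_ge_atTop 2) hσ
      (show (0 : ℝ) < 1 / 2 by norm_num) (half_pos hε), eventually_ge_atTop 1] with r h1 h2
    refine (measure_union_le _ _).trans ((add_le_add h1
      (betweenSS_le_le hp (by lia) hσa hκ0)).trans_eq ?_)
    rw [← ENNReal.ofReal_add (by positivity) (by positivity)]
    congr 1
    rw [hκ]; field_simp; ring
  · filter_upwards [eventually_ge_atTop 2] with r hr Y hY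
    rw [Set.mem_union, not_or] at hY
    have hr' : (2 : ℝ) ≤ r := by exact_mod_cast hr
    have hr1 : (0 : ℝ) < r - 1 := by linarith
    obtain ⟨a1, a2⟩ := within_bounds hY.1
    have b : κ ^ 2 / 2 * r < betweenSS Y := not_le.1 hY.2
    have hE : 0 < withinSS Y := lt_trans (by positivity) a1
    refine ⟨hE, ?_⟩
    calc κ ^ 2 / (3 * p * σ2) = κ ^ 2 / 2 * r / ((1 + 1 / 2) * (p * r * σ2)) := by
          field_simp; norm_num
      _ ≤ betweenSS Y / withinSS Y := by
          have := betweenSS_nonneg Y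
          gcongr
          refine a2.le.trans ?_
          gcongr; linarith

/-- The limiting ratio (σ² + r σa²)/((r-1)σ²) is at least σa²/σ² for every r. The tolerance 1/2
leaves a third of it. -/
theorem plimTop_of_tendsto_units_obs {α : ℝ} (hα : -1 < α) (hp : Tendsto p l atTop)
    (hr : Tendsto r l atTop) (hσ : 0 < σ2) (hσa : 0 < σa2) :
    PlimTop l (fun k => dataLaw (p k) (r k) μ σa2 σ2) fun _ Y => closedBF α Y := by
  have hσ' : (0 : ℝ) < σ2 := by exact_mod_cast hσ
  have hσa' : (0 : ℝ) < σa2 := by exact_mod_cast hσa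
  refine plimTop_of_tendsto_obs hα (hp.eventually_ge_atTop 2) hr fun ε hε =>
    ⟨1 / 3 * ((σa2 : ℝ) / σ2), _, by positivity,
      eventually_bad_le hp (hr.eventually_ge_atTop 2) hσ (show (0 : ℝ) < 1 / 2 by norm_num) hε, ?_⟩
  filter_upwards [hp.eventually_ge_atTop 2, hr.eventually_ge_atTop 2] with k hp2 hr2 Y hY
  obtain ⟨hE, hx, -⟩ := ratio_bounds (by lia) hr2 hσ (by norm_num) (by norm_num) hY
  have hr' : (2 : ℝ) ≤ r k := by exact_mod_cast hr2
  have hr1 : (0 : ℝ) < r k - 1 := by linarith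
  refine ⟨hE, le_trans ?_ hx⟩
  rw [show ((1 : ℝ) - 1 / 2) / (1 + 1 / 2) = 1 / 3 by norm_num]
  refine mul_le_mul_of_nonneg_left ?_ (by norm_num)
  rw [div_le_div_iff₀ hσ' (by positivity)]
  have : (σa2 : ℝ) * ((r k - 1) * σ2) ≤ σa2 * (r k * σ2) := by gcongr; linarith
  nlinarith [mul_pos hσ' hσ']

end Events

/-! ### Many units with a fixed number of observations -/

section FixedObs

variable {r : ℕ} {μ α : ℝ} {σa2 σ2 : ℝ≥0}

/-- The exponential rate of the Bayes factor at the limiting ratio of the sums of squares. -/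
theorem fixedObs_rate_eq (hr : 2 ≤ r) (hσ : 0 < σ2) :
    ((r : ℝ) - 1) * Real.log (1 + ((σ2 : ℝ) + r * σa2) / ((r - 1) * σ2)) - gammaRate r
      = (r - 1) * Real.log (1 + (σa2 : ℝ) / σ2) - Real.log r := by
  have hr' : (2 : ℝ) ≤ r := by exact_mod_cast hr
  have hr1 : (0 : ℝ) < r - 1 := by linarith
  have hσ' : (0 : ℝ) < σ2 := by exact_mod_cast hσ
  have e : 1 + ((σ2 : ℝ) + r * σa2) / ((r - 1) * σ2) = r * (1 + (σa2 : ℝ) / σ2) / (r - 1) := by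
    field_simp; ring
  rw [e, Real.log_div (by positivity) hr1.ne', Real.log_mul (by positivity) (by positivity),
    gammaRate]
  ring

/-- So h(r) is the zero of the limiting rate in `fixedObs_rate_eq`. -/
theorem log_threshold (hr : 2 ≤ r) :
    ((r : ℝ) - 1) * Real.log (1 + threshold r) = Real.log r := by
  have hr' : (2 : ℝ) ≤ r := by exact_mod_cast hr
  have hr1 : (r : ℝ) - 1 ≠ 0 := by linarith
  rw [threshold, add_sub_cancel, Real.log_rpow (by positivity)]
  field_simp

theorem threshold_nonneg (hr : 2 ≤ r) : 0 ≤ threshold r := by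
  have hr' : (2 : ℝ) ≤ r := by exact_mod_cast hr
  have : 1 ≤ (r : ℝ) ^ (1 / ((r : ℝ) - 1)) :=
    Real.one_le_rpow (by linarith) (by have : (0 : ℝ) < r - 1 := by linarith
                                       positivity)
  unfold threshold; linarith

/-- Here q stands for (1 - δ)/(1 + δ) or its inverse, the factors of `ratio_bounds`. A strict sign
of the limiting rate thus survives for some δ in (0, 1). -/
theorem tendsto_rate (hr : 2 ≤ r) (hσ : 0 < σ2) {q : ℝ → ℝ} (hq : ContinuousAt q 0) (hq0 : q 0 = 1) :
    Tendsto (fun δ => ((r : ℝ) - 1) *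
        Real.log (1 + q δ * (((σ2 : ℝ) + r * σa2) / ((r - 1) * σ2))) - gammaRate r) (𝓝[>] 0)
      (𝓝 ((r - 1) * Real.log (1 + (σa2 : ℝ) / σ2) - Real.log r)) := by
  have hr' : (2 : ℝ) ≤ r := by exact_mod_cast hr
  have hr1 : (0 : ℝ) < r - 1 := by linarith
  have hσ' : (0 : ℝ) < σ2 := by exact_mod_cast hσ
  rw [← fixedObs_rate_eq hr hσ]
  have h : Tendsto q (𝓝[>] 0) (𝓝 1) := by
    have := hq.tendsto; rw [hq0] at this; exact this.mono_left nhdsWithin_le_nhds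
  have h2 := (h.mul_const (((σ2 : ℝ) + r * σa2) / ((r - 1) * σ2))).const_add 1
  rw [one_mul] at h2
  exact ((h2.log (by positivity)).const_mul _).sub_const _

/-- Above the threshold the rate is positive, and its linear growth in p beats the logarithmic
error. -/
theorem plimTop_of_threshold_lt (hα : -1 < α) (hr : 2 ≤ r) (hσ : 0 < σ2)
    (h : threshold r < (σa2 : ℝ) / σ2) :
    PlimTop atTop (fun p : ℕ => dataLaw p r μ σa2 σ2) fun _ Y => closedBF α Y := by
  obtain ⟨C, hC0, hC⟩ := exists_abs_log_gammaFactor_add_le hα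
  have hr' : (2 : ℝ) ≤ r := by exact_mod_cast hr
  have hr1 : (0 : ℝ) < r - 1 := by linarith
  have hσ' : (0 : ℝ) < σ2 := by exact_mod_cast hσ
  have ht := threshold_nonneg hr
  have hpos : 0 < ((r : ℝ) - 1) * Real.log (1 + (σa2 : ℝ) / σ2) - Real.log r := by
    rw [← log_threshold hr]
    have := Real.log_lt_log (by linarith) (show 1 + threshold r < 1 + (σa2 : ℝ) / σ2 by linarith)
    nlinarith
  have hlim := tendsto_rate (σa2 := σa2) hr hσ (q := fun δ => (1 - δ) / (1 + δ))
    (ContinuousAt.div (by fun_prop) (by fun_prop) (by norm_num)) (by norm_num)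
  obtain ⟨δ, hδ, hδ0, hδ1⟩ := ((hlim.eventually (lt_mem_nhds hpos)).and
    (Ioo_mem_nhdsGT (zero_lt_one' ℝ))).exists
  set x := (1 - δ) / (1 + δ) * (((σ2 : ℝ) + r * σa2) / ((r - 1) * σ2)) with hx
  have hx0 : 0 ≤ x := by
    have : 0 ≤ 1 - δ := by linarith
    positivity
  set g := ((r : ℝ) - 1) * Real.log (1 + x) - gammaRate r with hg
  have hcast : Tendsto (fun p : ℕ => (p : ℝ)) atTop atTop := tendsto_natCast_atTop_atTop
  refine plimTop_of_le fun ε hε => ⟨fun p => Real.exp (g / 2 * p - C * Real.log p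
    + -((1 + α) * Real.log (1 + x) + C * Real.log r)), _, Real.tendsto_exp_atTop.comp
      (tendsto_atTop_add_const_right _ _ ((tendsto_mul_sub_log _ _ (half_pos hδ)).comp hcast)),
    eventually_bad_le (p := fun p => p) (r := fun _ => r) tendsto_id
      (Eventually.of_forall fun _ => hr) hσ hδ0 hε, ?_⟩
  filter_upwards [eventually_ge_atTop 2, hcast.eventually_ge_atTop (2 * (1 + α))]
    with p hp hpα Y hY
  have hp' : (2 : ℝ) ≤ p := by exact_mod_cast hp
  obtain ⟨hE, hX, -⟩ := ratio_bounds (by lia) hr hσ hδ0 hδ1 hY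
  refine le_trans (Real.exp_le_exp.2 ?_)
    (le_closedBF hp hr hα hE (hC _ _ hp hr) (by nlinarith) hx0 hX)
  rw [Real.log_mul (by positivity) (by positivity), ← hg]
  linarith

/-- Below the threshold the rate is negative, so for large p the closed form is at most 1 off events
of vanishing probability. -/
theorem not_plimTop_of_lt_threshold (hα : -1 < α) (hr : 2 ≤ r) (hσ : 0 < σ2)
    (h : (σa2 : ℝ) / σ2 < threshold r) :
    ¬ PlimTop atTop (fun p : ℕ => dataLaw p r μ σa2 σ2) fun _ Y => closedBF α Y := by
  obtain ⟨C, hC0, hC⟩ := exists_abs_log_gammaFactor_add_le hα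
  have hr' : (2 : ℝ) ≤ r := by exact_mod_cast hr
  have hr1 : (0 : ℝ) < r - 1 := by linarith
  have hσ' : (0 : ℝ) < σ2 := by exact_mod_cast hσ
  have hneg : ((r : ℝ) - 1) * Real.log (1 + (σa2 : ℝ) / σ2) - Real.log r < 0 := by
    rw [← log_threshold hr]
    have := Real.log_lt_log (by positivity)
      (show 1 + (σa2 : ℝ) / σ2 < 1 + threshold r by linarith)
    nlinarith
  have hlim := tendsto_rate (σa2 := σa2) hr hσ (q := fun δ => (1 + δ) / (1 - δ))
    (ContinuousAt.div (by fun_prop) (by fun_prop) (by norm_num)) (by norm_num)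
  obtain ⟨δ, hδ, hδ0, hδ1⟩ := ((hlim.eventually (gt_mem_nhds hneg)).and
    (Ioo_mem_nhdsGT (zero_lt_one' ℝ))).exists
  set x := (1 + δ) / (1 - δ) * (((σ2 : ℝ) + r * σa2) / ((r - 1) * σ2)) with hx
  set g := ((r : ℝ) - 1) * Real.log (1 + x) - gammaRate r with hg
  have hcast : Tendsto (fun p : ℕ => (p : ℝ)) atTop atTop := tendsto_natCast_atTop_atTop
  refine not_plimTop_of_le (C := 1) (fun ε hε => eventually_bad_le (p := fun p => p)
    (r := fun _ => r) tendsto_id (Eventually.of_forall fun _ => hr) hσ hδ0 hε) ?_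
  filter_upwards [eventually_ge_atTop 2, ((tendsto_mul_sub_log (-g / 2) C
    (by linarith)).comp hcast).eventually_ge_atTop (C * Real.log r)] with p hp hu Y hY
  have hp' : (2 : ℝ) ≤ p := by exact_mod_cast hp
  obtain ⟨hE, -, hX⟩ := ratio_bounds (by lia) hr hσ hδ0 hδ1 hY
  refine (closedBF_le hp hr hα hE (hC _ _ hp hr) hX).trans (Real.exp_le_one_iff.2 ?_)
  rw [Real.log_mul (by positivity) (by positivity), ← hg]
  simp only [Function.comp] at hu
  linarith

end FixedObs

end OneWay

theorem theorem2 (α c : ℝ) (hα : -1 < α) (hc : 0 < c) :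
    -- the Bayes factor under consideration is given by the closed form
    (∀ p r : ℕ, 2 ≤ p → 2 ≤ r → -1 < OneWay.shapeBeta p r α →
      ∀ Y : Fin p → Fin r → ℝ, 0 < OneWay.withinSS Y →
        OneWay.bayesFactor α c Y = ENNReal.ofReal (OneWay.closedBF α Y)) ∧
    -- (a) `p` fixed and `r → ∞`
    (∀ p : ℕ, 2 ≤ p → ∀ (μ : ℝ) (σa2 σ2 : ℝ≥0), 0 < σ2 →
      OneWay.IsConsistent α μ σa2 σ2 atTop (fun _ : ℕ => p) (fun r : ℕ => r)) ∧
    -- (b) `r` fixed and `p → ∞`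
    (∀ r : ℕ, 2 ≤ r → ∀ (μ : ℝ) (σ2 : ℝ≥0), 0 < σ2 →
      OneWay.IsConsistent α μ 0 σ2 atTop (fun p : ℕ => p) (fun _ : ℕ => r) ∧
      ∀ σa2 : ℝ≥0, 0 < σa2 →
        (OneWay.threshold r < (σa2 : ℝ) / σ2 →
          OneWay.IsConsistent α μ σa2 σ2 atTop (fun p : ℕ => p) (fun _ : ℕ => r)) ∧
        ((σa2 : ℝ) / σ2 < OneWay.threshold r →
          ¬ OneWay.IsConsistent α μ σa2 σ2 atTop (fun p : ℕ => p) (fun _ : ℕ => r))) ∧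
    -- (c) both `p → ∞` and `r → ∞`
    (∀ (μ : ℝ) (σa2 σ2 : ℝ≥0), 0 < σ2 →
      OneWay.IsConsistent α μ σa2 σ2 (atTop ×ˢ atTop)
        (fun k : ℕ × ℕ => k.1) (fun k : ℕ × ℕ => k.2)) := by
  refine ⟨fun p r hp hr hβ Y hE => OneWay.bayesFactor_eq_closedBF hp hr hα hc hβ Y hE,
    fun p hp μ σa2 σ2 hσ => ⟨fun h => ?_, fun h => ?_⟩,
    fun r hr μ σ2 hσ => ⟨⟨fun _ => ?_, fun h => (h rfl).elim⟩, fun σa2 hσa =>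
      ⟨fun h => ⟨fun h0 => (hσa.ne' h0).elim, fun _ => ?_⟩, fun h hcon => ?_⟩⟩,
    fun μ σa2 σ2 hσ => ⟨fun h => ?_, fun h => ?_⟩⟩
  · subst h
    exact OneWay.plimZero_of_fixed_units hα hp hσ
  · exact OneWay.plimTop_of_fixed_units hα hp hσ (pos_iff_ne_zero.2 h)
  · exact OneWay.plimZero_of_tendsto_units hα tendsto_id (Eventually.of_forall fun _ => hr) hσ
  · exact OneWay.plimTop_of_threshold_lt hα hr hσ h
  · exact OneWay.not_plimTop_of_lt_threshold hα hr hσ h (hcon.2 hσa.ne')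
  · subst h
    exact OneWay.plimZero_of_tendsto_units hα tendsto_fst
      (tendsto_snd.eventually_ge_atTop 2) hσ
  · exact OneWay.plimTop_of_tendsto_units_obs hα tendsto_fst tendsto_snd hσ
      (pos_iff_ne_zero.2 h)
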